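/- Let an $FL_{ew}$-algebra be a structure $\mathbf A=\langle A;\wedge,\vee,\cdot,\to,0,1\rangle$ where $\langle A;\wedge,\vee,0,1\rangle$ is a bounded lattice, $\langle A;\cdot,1\rangle$ is a commutative monoid, and $a\cdot b\le c\iff a\le b\to c$. It is a chain if it is linearly ordered; it is weakly saturated if, for all $a,b\in A$, $a\le b^n$ for all $n\in\mathbb N$ implies $ab=a$; it is $n$-contractive if $a^{n+1}=a^n$ for all $a\in A$. Modal formulas are built from a denumerable set of variables with $\wedge,\vee,\cdot,\to,0,1$ and the unary operators $\Box,\Diamond$ (with $\neg\varphi:=\varphi\to 0$). A Kripke frame is a non-empty set $W$ with a binary relation $R\subseteq W\times W$. An $\mathbf A$-Kripke model is a Kripke frame with a map $e$ assigning an element of $A$ to each world and each variable; $e$ is extended to all formulas by interpreting the propositional connectives world-wise by the operations of $\mathbf A$, and by $e(v,\Box\varphi)=\bigwedge_{Rvw}e(w,\varphi)$ and $e(v,\Diamond\varphi)=\bigvee_{Rvw}e(w,\varphi)$; the model is safe if all these infima and suprema exist. For a class $\mathcal C$ of safe models, a formula $\varphi$ and a finite set $\Gamma$ of formulas, write $\Gamma\vdash_{\mathcal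 C}\varphi$ if in every model of $\mathcal C$ in which all formulas of $\Gamma$ have value $1$ at every world, $\varphi$ has value $1$ at every world. This global logic $\vdash_{\mathcal C}$ is undecidable if no algorithm decides, given a finite set $\Gamma$ of formulas and a formula $\varphi$, whether $\Gamma\vdash_{\mathcal C}\varphi$. Its three-variable fragment is its restriction to formulas in three fixed variables. For a class $\mathcal F$ of frames and a class $\mathcal A$ of algebras, $\mathcal F_{\mathcal A}$ is the class of all safe $\mathbf A$-Kripke models with $\mathbf A\in\mathcal A$ and frame in $\mathcal F$; $K\mathcal A$ is the class of all safe $\mathbf A$-Kripke models with $\mathbf A\in\mathcal A$; and $\omega K\mathcal A$ is the class of those models in $K\mathcal A$ that have finitely many worlds. Let $\mathcal L$ be the class of all frames that are isomorphic, for some $k\in\mathbb N$, to $\langle\{0,\dots,k\},\{\langle i,i+1\rangle : i<k\}\rangle$. **Theorem.** Let $\mathcal A$ be a class of weakly saturated $FL_{ew}$-chains such that for every $n\in\mathbb N$ there is an algebra in $\mathcal A$ that is not $n$-contractive. Then for every class of frames $\mathcal F$ with $\mathcal L\subseteq\mathcal F$ the logic $\vdash_{\mathcal F_{\mathcal A}}$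 is undecidable. In particular, $\vdash_{K\mathcal A}$ and $\vdash_{\omega K\mathcal A}$ are undecidable. More precisely, the three-variable fragments of these logics are undecidable. All of this holds in particular for $\mathcal A=\{[0,1]_{\text{Ł}}\}$ and for $\mathcal A=\{[0,1]_{\Pi}\}$, where the universe of both algebras is the real interval $[0,1]$ with its usual order, $[0,1]_{\text{Ł}}$ has $a\cdot b=\max\{0,a+b-1\}$ and $a\to b=\min\{1,1-a+b\}$, and $[0,1]_{\Pi}$ has the product of real numbers as $\cdot$, and $a\to b=1$ if $a\le b$ and $b/a$ otherwise. -/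

import Mathlib

universe u v

namespace ModalFLew

/-! ### Algebras -/

/-- `FLew`-algebras `⟨A; ⊓, ⊔, *, ⇨, ⊥, 1⟩`: bounded commutative integral residuated lattices.
The constant `0` of the language is `⊥`, and the constant `1` is both the unit and the top. -/
class FLew (A : Type*) extends Lattice A, BoundedOrder A, CommMonoid A, HImp A where
  one_eq_top : (1 : A) = ⊤
  mul_le_iff_le_himp : ∀ a b c : A, a * b ≤ c ↔ a ≤ b ⇨ c

/-- A bundled `FLew`-algebra; classes of algebras are sets of these. -/
structure Alg where
  carrier : Type v
  [str : FLew carrier]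

instance : CoeSort Alg.{v} (Type v) := ⟨Alg.carrier⟩

instance (A : Alg.{v}) : FLew A := A.str

/-- `A` is a chain: its order is linear. -/
def Alg.IsChain (A : Alg.{v}) : Prop := ∀ a b : A, a ≤ b ∨ b ≤ a

/-- `A` is `n`-contractive. -/
def Alg.IsContractive (A : Alg.{v}) (n : ℕ) : Prop := ∀ a : A, a ^ (n + 1) = a ^ n

/-- `A` is weakly saturated. -/
def Alg.IsWeaklySaturated (A : Alg.{v}) : Prop :=
  ∀ a b : A, (∀ n : ℕ, a ≤ b ^ n) → a * b = a

/-! ### The standard algebras on the real unit interval -/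

/-- The Łukasiewicz product `max 0 (a + b - 1)` on `[0,1]`. -/
noncomputable def lukMul (a b : unitInterval) : unitInterval :=
  ⟨max 0 (a.1 + b.1 - 1), by
    have ha := a.2.2; have hb := b.2.2
    exact ⟨le_max_left _ _, max_le zero_le_one (by linarith)⟩⟩

/-- The Łukasiewicz implication `min 1 (1 - a + b)` on `[0,1]`. -/
noncomputable def lukImp (a b : unitInterval) : unitInterval :=
  ⟨min 1 (1 - a.1 + b.1), by
    have ha := a.2.2; have hb := b.2.1
    exact ⟨le_min zero_le_one (by linarith), min_le_left _ _⟩⟩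

/-- The Łukasiewicz operations on `[0,1]` with its usual order. -/
noncomputable abbrev lukasiewiczFLew : FLew unitInterval where
  __ := (inferInstance : Lattice unitInterval)
  __ := (inferInstance : BoundedOrder unitInterval)
  one := 1
  mul := lukMul
  himp := lukImp
  npow := @npowRec unitInterval ⟨1⟩ ⟨lukMul⟩
  npow_zero _ := rfl
  npow_succ _ _ := rfl
  mul_assoc a b c := Subtype.ext (by
    change max 0 (max 0 (a.1 + b.1 - 1) + c.1 - 1) = max 0 (a.1 + max 0 (b.1 + c.1 - 1) - 1)
    have ha := a.2.2; have hc := c.2.2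
    grind)
  one_mul a := Subtype.ext (by
    change max 0 (1 + a.1 - 1) = a.1
    have ha := a.2.1
    grind)
  mul_one a := Subtype.ext (by
    change max 0 (a.1 + 1 - 1) = a.1
    have ha := a.2.1
    grind)
  mul_comm a b := Subtype.ext (by
    change max 0 (a.1 + b.1 - 1) = max 0 (b.1 + a.1 - 1)
    grind)
  one_eq_top := rfl
  mul_le_iff_le_himp a b c := by
    change max 0 (a.1 + b.1 - 1) ≤ c.1 ↔ a.1 ≤ min 1 (1 - b.1 + c.1)
    have ha := a.2.2; have hc := c.2.1
    grind

open Classical in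
/-- The Product operations on `[0,1]`: `*` is the product of real numbers, and `a ⇨ b` is
`1` if `a ≤ b` and the quotient `b / a` otherwise. -/
noncomputable abbrev productFLew : FLew unitInterval where
  __ := (inferInstance : Lattice unitInterval)
  __ := (inferInstance : BoundedOrder unitInterval)
  __ := (inferInstance : CommMonoid unitInterval)
  himp a b := if h : a.1 ≤ b.1 then 1 else ⟨b.1 / a.1,
    div_nonneg b.2.1 a.2.1, div_le_one_of_le₀ (le_of_not_ge h) a.2.1⟩
  one_eq_top := rfl
  mul_le_iff_le_himp a b c := by
    have ha := a.2.2; have ha0 := a.2.1; have hb := b.2.1; have hc := c.2.1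
    change a.1 * b.1 ≤ c.1 ↔ a ≤ dite (b.1 ≤ c.1) _ _
    split_ifs with h
    · exact iff_of_true ((mul_le_of_le_one_left hb ha).trans h) a.2.2
    · rw [← Subtype.coe_le_coe, le_div_iff₀ (lt_of_le_of_lt hc (not_le.mp h))]

/-- The standard MV-algebra. -/
noncomputable def standardLukasiewicz : Alg.{0} := @Alg.mk unitInterval lukasiewiczFLew

/-- The standard Product algebra. -/
noncomputable def standardProduct : Alg.{0} := @Alg.mk unitInterval productFLew

/-! ### Modal formulas -/

/-- Modal formulas over the variables `var 0, var 1, …`. Negation `¬ φ` is `φ → 0`. -/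
inductive Fm : Type
  | zero : Fm
  | one : Fm
  | var : ℕ → Fm
  | and : Fm → Fm → Fm
  | or : Fm → Fm → Fm
  | mul : Fm → Fm → Fm
  | imp : Fm → Fm → Fm
  | box : Fm → Fm
  | dia : Fm → Fm

namespace Fm

/-- The variables that occur in a formula. -/
def vars : Fm → Finset ℕ
  | zero => ∅
  | one => ∅
  | var i => {i}
  | and φ ψ => φ.vars ∪ ψ.vars
  | or φ ψ => φ.vars ∪ ψ.vars
  | mul φ ψ => φ.vars ∪ ψ.vars
  | imp φ ψ => φ.vars ∪ ψ.vars
  | box φ => φ.vars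
  | dia φ => φ.vars

/-- An effective Gödel numbering of the formulas. -/
def code : Fm → ℕ
  | zero => 0
  | one => 1
  | var i => 7 * i + 2
  | and φ ψ => 7 * Nat.pair φ.code ψ.code + 3
  | or φ ψ => 7 * Nat.pair φ.code ψ.code + 4
  | mul φ ψ => 7 * Nat.pair φ.code ψ.code + 5
  | imp φ ψ => 7 * Nat.pair φ.code ψ.code + 6
  | box φ => 7 * φ.code + 7
  | dia φ => 7 * φ.code + 8

theorem code_injective : Function.Injective code := by
  intro φ
  induction φ with
  | zero => intro ψ h; cases ψ <;> simp only [code] at h <;> first | rfl | omega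
  | one => intro ψ h; cases ψ <;> simp only [code] at h <;> first | rfl | omega
  | var i =>
    intro ψ h
    cases ψ <;> simp only [code] at h <;> first | omega | skip
    congr 1; omega
  | and φ₁ φ₂ ih₁ ih₂ | or φ₁ φ₂ ih₁ ih₂ | mul φ₁ φ₂ ih₁ ih₂ | imp φ₁ φ₂ ih₁ ih₂ =>
    intro ψ h
    cases ψ <;> simp only [code] at h <;> first | omega | skip
    obtain ⟨h₁, h₂⟩ := Nat.pair_eq_pair.mp (mul_left_cancel₀ (by norm_num) (add_right_cancel h))
    rw [ih₁ h₁, ih₂ h₂]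
  | box φ ih | dia φ ih =>
    intro ψ h
    cases ψ <;> simp only [code] at h <;> first | omega | skip
    rw [ih (mul_left_cancel₀ (by norm_num) (add_right_cancel h))]

theorem code_surjective : Function.Surjective code := by
  intro n
  induction n using Nat.strong_induction_on with
  | _ n ih =>
    obtain rfl | rfl | hn : n = 0 ∨ n = 1 ∨ 2 ≤ n := by omega
    · exact ⟨zero, rfl⟩
    · exact ⟨one, rfl⟩
    · obtain ⟨q, hq⟩ : ∃ q, q = (n - 2) / 7 := ⟨_, rfl⟩
      have hl := Nat.unpair_left_le q
      have hr := Nat.unpair_right_le q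
      obtain ⟨φ, hφ⟩ := ih q (by omega)
      obtain ⟨φ₁, h₁⟩ := ih q.unpair.1 (by omega)
      obtain ⟨φ₂, h₂⟩ := ih q.unpair.2 (by omega)
      have hp : Nat.pair φ₁.code φ₂.code = q := by rw [h₁, h₂, Nat.pair_unpair]
      obtain h | h | h | h | h | h | h : n = 7 * q + 2 ∨ n = 7 * q + 3 ∨ n = 7 * q + 4 ∨
          n = 7 * q + 5 ∨ n = 7 * q + 6 ∨ n = 7 * q + 7 ∨ n = 7 * q + 8 := by omega
      · exact ⟨var q, h.symm⟩
      · exact ⟨and φ₁ φ₂, by rw [code, hp, h]⟩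
      · exact ⟨or φ₁ φ₂, by rw [code, hp, h]⟩
      · exact ⟨mul φ₁ φ₂, by rw [code, hp, h]⟩
      · exact ⟨imp φ₁ φ₂, by rw [code, hp, h]⟩
      · exact ⟨box φ, by rw [code, hφ, h]⟩
      · exact ⟨dia φ, by rw [code, hφ, h]⟩

/-- Formulas are numbered by `code`, so that Mathlib's notion of a computable predicate applies
to them. -/
noncomputable instance : Denumerable Fm :=
  Denumerable.mk' (Equiv.ofBijective code ⟨code_injective, code_surjective⟩)

theorem encode_eq_code (φ : Fm) : Encodable.encode φ = φ.code := rfl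

end Fm

/-! ### Kripke models -/

/-- A Kripke frame: a non-empty set of worlds with a binary relation. -/
structure Frame where
  World : Type u
  rel : World → World → Prop
  [nonempty : Nonempty World]

/-- A Kripke model over an `FLew`-algebra: a frame and a valuation of the variables. -/
structure Model where
  alg : Alg.{v}
  frame : Frame.{u}
  val : frame.World → ℕ → alg

namespace Model

open Classical in
/-- The value of a formula at a world. The values of `□ φ` and `◇ φ` are the infimum and the
supremum of the values of `φ` at the successors; where one of these does not exist, a dummy value
is taken, and `Safe` below excludes the models in which this happens. -/
noncomputable def eval (M : Model.{u, v}) : Fm → M.frame.World → M.alg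
  | .zero => fun _ => ⊥
  | .one => fun _ => 1
  | .var i => fun v => M.val v i
  | .and φ ψ => fun v => M.eval φ v ⊓ M.eval ψ v
  | .or φ ψ => fun v => M.eval φ v ⊔ M.eval ψ v
  | .mul φ ψ => fun v => M.eval φ v * M.eval ψ v
  | .imp φ ψ => fun v => M.eval φ v ⇨ M.eval ψ v
  | .box φ => fun v =>
      if h : ∃ a, IsGLB (M.eval φ '' {w | M.frame.rel v w}) a then h.choose else ⊥
  | .dia φ => fun v =>
      if h : ∃ a, IsLUB (M.eval φ '' {w | M.frame.rel v w}) a then h.choose else ⊥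

/-- A model is safe if all infima and suprema that are needed to evaluate formulas exist. -/
def Safe (M : Model.{u, v}) : Prop :=
  ∀ (φ : Fm) (v : M.frame.World),
    (∃ a, IsGLB (M.eval φ '' {w | M.frame.rel v w}) a) ∧
    (∃ a, IsLUB (M.eval φ '' {w | M.frame.rel v w}) a)

/-- `M ⊨ φ`: the formula has value `1` at every world. -/
def Satisfies (M : Model.{u, v}) (φ : Fm) : Prop := ∀ v, M.eval φ v = 1

end Model

/-- `K 𝒜`: the class of all safe Kripke models over the algebras in `𝒜`. -/
def K (𝒜 : Set Alg.{v}) : Set Model.{u, v} := {M | M.alg ∈ 𝒜 ∧ M.Safe}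

/-- `ω 𝒞`: the models in `𝒞` with finitely many worlds. -/
def finiteModels (𝒞 : Set Model.{u, v}) : Set Model.{u, v} := {M ∈ 𝒞 | Finite M.frame.World}

/-- `ℱ_𝒜`: the class of all safe Kripke models over the algebras in `𝒜` whose frame is in `ℱ`. -/
def modelsOver (ℱ : Set Frame.{u}) (𝒜 : Set Alg.{v}) : Set Model.{u, v} :=
  {M | M.frame ∈ ℱ ∧ M.alg ∈ 𝒜 ∧ M.Safe}

/-- The class `L` of the finite chains: all frames that are isomorphic, for some `k`, to
`{0, …, k}` with the relation `{(i, i + 1) | i < k}`. -/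
def chainFrames : Set Frame.{u} :=
  {F | ∃ k : ℕ, Nonempty (F.rel ≃r fun i j : Fin (k + 1) => (j : ℕ) = (i : ℕ) + 1)}

/-! ### Global consequence and its decision problem -/

/-- `φ` globally follows from the finite set of premises `Γ` in the class of models `𝒞`. -/
def GloballyFollows (𝒞 : Set Model.{u, v}) (Γ : Set Fm) (φ : Fm) : Prop :=
  ∀ M ∈ 𝒞, (∀ γ ∈ Γ, M.Satisfies γ) → M.Satisfies φ

/-- The global logic of `𝒞` is decidable: there is an algorithm that, given a finite set of
premises (as a list) and a formula, decides whether the formula globally follows. -/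
def GlobalLogicDecidable (𝒞 : Set Model.{u, v}) : Prop :=
  ComputablePred fun p : List Fm × Fm => GloballyFollows 𝒞 {γ | γ ∈ p.1} p.2

/-- The fragment of the global logic of `𝒞` in the variables from `V`, which consists of the pairs
`(Γ, φ)` in these variables with `φ` following from `Γ`, is decidable. -/
def GlobalFragmentDecidable (𝒞 : Set Model.{u, v}) (V : Finset ℕ) : Prop :=
  ComputablePred fun p : List Fm × Fm =>
    (∀ γ ∈ p.1, γ.vars ⊆ V) ∧ p.2.vars ⊆ V ∧ GloballyFollows 𝒞 {γ | γ ∈ p.1} p.2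

/-- The global logic of `𝒞` is undecidable, and so is its fragment in any three variables. -/
def UndecidableInThreeVariables (𝒞 : Set Model.{u, v}) : Prop :=
  ¬ GlobalLogicDecidable 𝒞 ∧ ∀ V : Finset ℕ, V.card = 3 → ¬ GlobalFragmentDecidable 𝒞 V

end ModalFLew

namespace ModalFLew

/-! ### A language of while-programs over registers -/

/-! The halting problem of while-programs is reduced to the failure of a global consequence, with
numbers carried as exponents of a single algebra element.

A program state becomes a number: a prime naming the programs still to be run, times a product of
primes whose exponents are the registers. A program step is then affine, `α s + β ↦ γ s + δ`. Powers
of 2 carry no information and pad the result, so that every rule has `α < γ` and `β < δ`. Halting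
means reaching a positive multiple of a fixed prime `h` (`exists_undecidable_rewriting`). A formula
cannot quantify over `s`, so `PairStep` replaces `N` by pairs `(N + b, b)`, in which `b` is a guess
for `s`, built up by unit steps and reset after each rule (`rewriting_iff_pairStep`).

A world carries the pair `(a, b)` when `x = z ^ a` and `y = z ^ b`. The premises make `z` constant
along the relation, make all successors agree on the variables, put `(N, 0)` at dead ends, and
derive the pair of any other world from that of its successors by one step. The goal says that
matching the target pattern implies `x → x z`.

If the target is reachable, a path reaching it, read backwards, is a finite chain model. With `c ^
(n + 1) ≠ c ^ n` for the target exponent `n`, the goal fails at its first world. Conversely, in any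
model of the premises each world has a reachable pair, or satisfies `x z = x`, or has `x ≤ z ^ n`
for every `n`, because each step adds a factor below `z` (`Model.saturated_or_reachable_or_le`).
Weak saturation turns the last case into `x z = x`, where the goal is trivial. At a reachable pair
that is not a target, the two compared powers of `z` have different exponents, and
`FLew.himp_le_himp_pow_mul` gives the goal. -/

/-- Programs over registers with natural number contents. The program `wh r a` is
`while r ≠ 0 do (r := r - 1; a)`. -/
inductive Stmt : Type
  | skip : Stmt
  | inc (r : ℕ) : Stmt
  | seq (a b : Stmt) : Stmt
  | wh (r : ℕ) (a : Stmt) : Stmt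
  deriving Encodable

open Function (update)

/-- Big-step semantics of programs. -/
inductive Exec : Stmt → (ℕ → ℕ) → (ℕ → ℕ) → Prop
  | skip (σ) : Exec .skip σ σ
  | inc (r σ) : Exec (.inc r) σ (update σ r (σ r + 1))
  | seq {a b σ τ ρ} : Exec a σ τ → Exec b τ ρ → Exec (.seq a b) σ ρ
  | wh_zero {r a σ} : σ r = 0 → Exec (.wh r a) σ σ
  | wh_succ {r a σ τ ρ n} : σ r = n + 1 → Exec a (update σ r n) τ → Exec (.wh r a) τ ρ →
      Exec (.wh r a) σ ρ

namespace Exec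

theorem seq_iff {a b : Stmt} {σ ρ : ℕ → ℕ} :
    Exec (.seq a b) σ ρ ↔ ∃ τ, Exec a σ τ ∧ Exec b τ ρ :=
  ⟨fun h => by cases h with | seq h₁ h₂ => exact ⟨_, h₁, h₂⟩, fun ⟨_, h₁, h₂⟩ => .seq h₁ h₂⟩

/-- Used to read off definedness of a function from a halting run: intermediate states of the run
must be the expected ones. -/
theorem deterministic {c : Stmt} {σ τ τ' : ℕ → ℕ} (h : Exec c σ τ) (h' : Exec c σ τ') :
    τ = τ' := by
  induction h generalizing τ' with
  | skip σ => cases h'; rfl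
  | inc r σ => cases h'; rfl
  | seq _ _ ih₁ ih₂ =>
    cases h' with
    | seq h₁ h₂ => obtain rfl := ih₁ h₁; exact ih₂ h₂
  | wh_zero h =>
    cases h' with
    | wh_zero _ => rfl
    | wh_succ h' _ _ => omega
  | wh_succ h _ _ ih₁ ih₂ =>
    cases h' with
    | wh_zero h' => omega
    | wh_succ h' h₁ h₂ =>
      obtain rfl : _ = _ := Nat.succ_injective (h.symm.trans h')
      obtain rfl := ih₁ h₁
      exact ih₂ h₂

theorem clear (r : ℕ) (σ : ℕ → ℕ) : Exec (.wh r .skip) σ (update σ r 0) := by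
  obtain ⟨n, hn⟩ : ∃ n, σ r = n := ⟨_, rfl⟩
  induction n generalizing σ with
  | zero => convert wh_zero hn; funext s; grind [Function.update_apply]
  | succ n ih =>
    refine wh_succ hn (skip _) ?_
    convert ih (update σ r n) (by simp) using 1
    simp

theorem transfer {r s : ℕ} (hrs : r ≠ s) (σ : ℕ → ℕ) :
    Exec (.wh r (.inc s)) σ (update (update σ s (σ s + σ r)) r 0) := by
  obtain ⟨n, hn⟩ : ∃ n, σ r = n := ⟨_, rfl⟩
  induction n generalizing σ with
  | zero => convert wh_zero hn; funext s; grind [Function.update_apply]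
  | succ n ih =>
    refine wh_succ hn (inc _ _) ?_
    convert ih (update (update σ r n) s (update σ r n s + 1)) (by grind [Function.update_apply])
      using 1
    funext q; grind [Function.update_apply]

/-- `s := s + r`, with the auxiliary register `t`. -/
theorem copy {r s t : ℕ} (hrs : r ≠ s) (hrt : r ≠ t) (hst : s ≠ t) (σ : ℕ → ℕ) (ht : σ t = 0) :
    Exec (.seq (.wh r (.seq (.inc s) (.inc t))) (.wh t (.inc r))) σ
      (update σ s (σ s + σ r)) := by
  have key : ∀ n, ∀ σ : ℕ → ℕ, σ r = n → Exec (.wh r (.seq (.inc s) (.inc t))) σ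
      (update (update (update σ s (σ s + n)) t (σ t + n)) r 0) := by
    intro n
    induction n with
    | zero => intro σ hn; convert wh_zero hn; funext s; grind [Function.update_apply]
    | succ n ih =>
      intro σ hn
      refine wh_succ hn (seq (inc _ _) (inc _ _)) ?_
      let τ := update (update σ r n) s (update σ r n s + 1)
      convert ih (update τ t (τ t + 1)) (by grind [Function.update_apply]) using 1
      funext q; grind [Function.update_apply]
  refine seq (key _ σ rfl) ?_
  convert transfer hrt.symm _ using 1
  funext q; grind [Function.update_apply]

end Exec

/-! ### Compiling partial recursive functions into programs -/

/-- A partial function is realizable if, for any registers for the arguments and the result and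
any bound `m` above them, a program adds its value to the result register, using registers from
`m` on, which are supposed to be `0`, for auxiliary purposes only. -/
def Realizable {n : ℕ} (f : List.Vector ℕ n →. ℕ) : Prop :=
  ∀ (ins : Fin n → ℕ) (out m : ℕ), (∀ i, ins i < m) → out < m → (∀ i, ins i ≠ out) →
    ∃ c, ∀ σ : ℕ → ℕ, (∀ r, m ≤ r → σ r = 0) →
      (∀ y ∈ f (List.Vector.ofFn (σ ∘ ins)), Exec c σ (update σ out (σ out + y))) ∧
      (∀ τ, Exec c σ τ → (f (List.Vector.ofFn (σ ∘ ins))).Dom)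

theorem mem_mOfFn_iff {n : ℕ} {g : Fin n → Part ℕ} {w : List.Vector ℕ n} :
    w ∈ List.Vector.mOfFn g ↔ ∀ i, w.get i ∈ g i := by
  induction n with
  | zero =>
    simp only [List.Vector.mOfFn, IsEmpty.forall_iff, iff_true]
    rw [List.Vector.eq_nil w]
    exact Part.mem_some _
  | succ n ih =>
    simp only [List.Vector.mOfFn, Part.bind_eq_bind, Part.mem_bind_iff, Fin.forall_fin_succ]
    constructor
    · rintro ⟨a, ha, b, hb, h⟩
      obtain rfl := Part.mem_some_iff.mp h
      exact ⟨by simpa using ha, by simpa using ih.mp hb⟩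
    · rintro ⟨h₀, h⟩
      refine ⟨_, h₀, w.tail, ih.mpr fun i => by simpa using h i, Part.mem_some_iff.mpr ?_⟩
      rw [List.Vector.get_zero, List.Vector.cons_head_tail]

/-- The register contents `σ` with `w 0, …, w (k - 1)` written from the register `m` on. -/
def fillFrom (σ : ℕ → ℕ) (m k : ℕ) (w : ℕ → ℕ) (r : ℕ) : ℕ :=
  if m ≤ r ∧ r < m + k then w (r - m) else σ r

theorem exists_exec_clear (m k : ℕ) : ∃ c, ∀ σ : ℕ → ℕ, Exec c σ (fillFrom σ m k fun _ => 0) := by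
  induction k with
  | zero => exact ⟨.skip, fun σ => by convert Exec.skip σ using 1; funext r; grind [fillFrom]⟩
  | succ k ih =>
    obtain ⟨c, hc⟩ := ih
    refine ⟨.seq c (.wh (m + k) .skip), fun σ => .seq (hc σ) ?_⟩
    convert Exec.clear (m + k) _ using 1
    funext r; grind [fillFrom, Function.update_apply]

/-- Evaluates the inner functions of a composition one after another. The scratch bound `M` is kept
apart from `m + k` so that it stays fixed in the induction on `k`. -/
theorem exists_exec_fill {n k : ℕ} {g : Fin k → List.Vector ℕ n →. ℕ}
    (hg : ∀ i, Realizable (g i)) (ins : Fin n → ℕ) (m M : ℕ) (hM : m + k ≤ M)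
    (hins : ∀ i, ins i < m) :
    ∃ c, ∀ σ : ℕ → ℕ, (∀ r, m ≤ r → σ r = 0) →
      (∀ w : ℕ → ℕ, (∀ i : Fin k, w i ∈ g i (List.Vector.ofFn (σ ∘ ins))) →
        Exec c σ (fillFrom σ m k w)) ∧
      (∀ τ, Exec c σ τ → ∀ i, (g i (List.Vector.ofFn (σ ∘ ins))).Dom) := by
  induction k with
  | zero =>
    refine ⟨.skip, fun σ _ => ⟨fun w _ => ?_, fun τ _ i => i.elim0⟩⟩
    convert Exec.skip σ using 1; funext r; grind [fillFrom]
  | succ k ih =>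
    obtain ⟨c, hc⟩ := ih (fun i => hg i.castSucc) (by omega)
    obtain ⟨d, hd⟩ := hg (Fin.last k) ins (m + k) M (fun i => by have := hins i; omega) (by omega)
      (fun i => by have := hins i; omega)
    refine ⟨.seq c d, fun σ hσ => ?_⟩
    obtain ⟨hc₁, hc₂⟩ := hc σ hσ
    have hv : ∀ w, List.Vector.ofFn (fillFrom σ m k w ∘ ins) = List.Vector.ofFn (σ ∘ ins) := by
      intro w; congr 1; funext i; have := hins i; grind [fillFrom]
    have hz : ∀ w r, M ≤ r → fillFrom σ m k w r = 0 := by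
      intro w r hr; have := hσ r (by omega); grind [fillFrom]
    refine ⟨fun w hw => ?_, fun τ hτ => ?_⟩
    · refine .seq (hc₁ w fun i => hw i.castSucc) ?_
      convert (hd _ (hz w)).1 (w k) (by rw [hv]; exact hw (Fin.last k)) using 1
      have := hσ (m + k) (by omega)
      funext r
      simp only [fillFrom, Function.update_apply]
      split_ifs <;> first | omega | skip
      subst_vars
      simp [this]
    · obtain ⟨τ', h₁, h₂⟩ := Exec.seq_iff.mp hτ
      have hdom := hc₂ _ h₁
      classical
      -- The values that the halting run of `c` must have computed; by determinism it ends in the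
      -- state filled with them. Beyond `k` the value is a dummy.
      let w : ℕ → ℕ := fun i => if h : i < k then (g (Fin.castSucc ⟨i, h⟩) _).get (hdom ⟨i, h⟩)
        else 0
      have hw : ∀ i : Fin k, w i ∈ g i.castSucc (List.Vector.ofFn (σ ∘ ins)) := by
        intro i
        simp only [w, i.2, dif_pos]
        exact Part.get_mem _
      obtain rfl := h₁.deterministic (hc₁ w hw)
      have := (hd _ (hz w)).2 τ h₂
      rw [hv] at this
      exact Fin.lastCases this hdom

theorem Realizable.comp {m n : ℕ} {f : List.Vector ℕ n →. ℕ} {g : Fin n → List.Vector ℕ m →. ℕ}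
    (hf : Realizable f) (hg : ∀ i, Realizable (g i)) :
    Realizable fun v => (List.Vector.mOfFn fun i => g i v) >>= f := by
  intro ins out M hins hout hne
  obtain ⟨c, hc⟩ := exists_exec_fill hg ins M (M + n) le_rfl hins
  obtain ⟨d, hd⟩ := hf (fun i => M + i) out (M + n) (fun i => by omega) (by omega)
    (fun i => by omega)
  obtain ⟨e, he⟩ := exists_exec_clear M n
  refine ⟨.seq c (.seq d e), fun σ hσ => ?_⟩
  obtain ⟨hc₁, hc₂⟩ := hc σ hσ
  have hv : ∀ w : ℕ → ℕ, List.Vector.ofFn (fillFrom σ M n w ∘ fun i : Fin n => M + (i : ℕ)) =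
      List.Vector.ofFn fun i => w i := by
    intro w; congr 1; funext i; have := i.2; grind [fillFrom]
  have hz : ∀ w r, M + n ≤ r → fillFrom σ M n w r = 0 := by
    intro w r hr; have := hσ r (by omega); grind [fillFrom]
  refine ⟨fun y hy => ?_, fun τ hτ => ?_⟩
  · obtain ⟨w, hw, hy⟩ := Part.mem_bind_iff.mp hy
    rw [mem_mOfFn_iff] at hw
    let w' : ℕ → ℕ := fun i => if h : i < n then w.get ⟨i, h⟩ else 0
    have hw' : (List.Vector.ofFn fun i : Fin n => w' i) = w := by
      refine List.Vector.ext fun i => ?_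
      simp [w']
    refine .seq (hc₁ w' fun i => by simpa [w'] using hw i)
      (.seq ((hd _ (hz w')).1 y (by rw [hv, hw']; exact hy)) ?_)
    convert he _ using 1
    funext r
    have := hσ r
    grind [fillFrom, Function.update_apply]
  · obtain ⟨τ₁, h₁, h₂⟩ := Exec.seq_iff.mp hτ
    obtain ⟨τ₂, h₂, h₃⟩ := Exec.seq_iff.mp h₂
    have hdom := hc₂ _ h₁
    classical
    let w : ℕ → ℕ := fun i => if h : i < n then (g ⟨i, h⟩ _).get (hdom ⟨i, h⟩) else 0
    have hw : ∀ i : Fin n, w i ∈ g i (List.Vector.ofFn (σ ∘ ins)) := by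
      intro i
      simp only [w, i.2, dif_pos]
      exact Part.get_mem _
    obtain rfl := h₁.deterministic (hc₁ w hw)
    have := (hd _ (hz w)).2 _ h₂
    rw [hv] at this
    obtain ⟨y, hy⟩ := Part.dom_iff_mem.mp this
    exact Part.dom_iff_mem.mpr ⟨y, Part.mem_bind_iff.mpr ⟨_, mem_mOfFn_iff.mpr fun i =>
      by simpa using hw i, hy⟩⟩

theorem realizable_of_total {n : ℕ} {f : List.Vector ℕ n → ℕ}
    (h : ∀ (ins : Fin n → ℕ) (out m : ℕ), (∀ i, ins i < m) → out < m → (∀ i, ins i ≠ out) →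
      ∃ c, ∀ σ : ℕ → ℕ, (∀ r, m ≤ r → σ r = 0) →
        Exec c σ (update σ out (σ out + f (List.Vector.ofFn (σ ∘ ins))))) :
    Realizable (f : List.Vector ℕ n →. ℕ) := by
  intro ins out m h₁ h₂ h₃
  obtain ⟨c, hc⟩ := h ins out m h₁ h₂ h₃
  refine ⟨c, fun σ hσ => ⟨fun y hy => ?_, fun _ _ => trivial⟩⟩
  obtain rfl := Part.mem_some_iff.mp hy
  exact hc σ hσ

theorem Realizable.exists_exec {n : ℕ} {f : List.Vector ℕ n → ℕ}
    (h : Realizable (f : List.Vector ℕ n →. ℕ)) (ins : Fin n → ℕ) (out m : ℕ)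
    (h₁ : ∀ i, ins i < m) (h₂ : out < m) (h₃ : ∀ i, ins i ≠ out) :
    ∃ c, ∀ σ : ℕ → ℕ, (∀ r, m ≤ r → σ r = 0) →
      Exec c σ (update σ out (σ out + f (List.Vector.ofFn (σ ∘ ins)))) := by
  obtain ⟨c, hc⟩ := h ins out m h₁ h₂ h₃
  exact ⟨c, fun σ hσ => (hc σ hσ).1 _ (Part.mem_some _)⟩

theorem Realizable.prec {n : ℕ} {f : List.Vector ℕ n → ℕ} {g : List.Vector ℕ (n + 2) → ℕ}
    (hf : Realizable (f : List.Vector ℕ n →. ℕ)) (hg : Realizable (g : List.Vector ℕ (n + 2) →. ℕ)) :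
    Realizable (fun v : List.Vector ℕ (n + 1) =>
      (Nat.rec (f v.tail) (fun y IH => g (y ::ᵥ IH ::ᵥ v.tail)) v.head : ℕ) :
        List.Vector ℕ (n + 1) →. ℕ) := by
  refine realizable_of_total fun ins out m hins hout hne => ?_
  obtain ⟨c, hc⟩ := hf.exists_exec (fun i => ins i.succ) (m + 2) (m + 4)
    (fun i => by have := hins i.succ; omega) (by omega) (fun i => by have := hins i.succ; omega)
  obtain ⟨d, hd⟩ := hg.exists_exec (Fin.cons (m + 1) (Fin.cons (m + 2) fun i => ins i.succ))
    (m + 3) (m + 4)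
    (by refine Fin.cases (by simp) (Fin.cases (by simp) fun i => ?_)
        have := hins i.succ; simp only [Fin.cons_succ]; omega) (by omega)
    (by refine Fin.cases (by simp) (Fin.cases (by simp) fun i => ?_)
        have := hins i.succ; simp only [Fin.cons_succ]; omega)
  -- Register `m` counts down, `m + 1` holds the index `j`, `m + 2` the value `F j`, and `m + 3`
  -- receives the next value before it is moved to `m + 2`.
  let body : Stmt := .seq d (.seq (.wh (m + 2) .skip) (.seq (.wh (m + 3) (.inc (m + 2)))
    (.inc (m + 1))))
  refine ⟨.seq (.seq (.wh (ins 0) (.seq (.inc m) (.inc (m + 1)))) (.wh (m + 1) (.inc (ins 0))))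
    (.seq c (.seq (.wh m body) (.seq (.wh (m + 1) .skip) (.wh (m + 2) (.inc out))))),
    fun σ hσ => ?_⟩
  have h0 := hins 0
  have hn0 := hne 0
  have z0 := hσ m le_rfl
  have z1 := hσ (m + 1) (by omega)
  have z2 := hσ (m + 2) (by omega)
  have z3 := hσ (m + 3) (by omega)
  set v := List.Vector.ofFn (fun i => σ (ins (Fin.succ i))) with hv
  let F : ℕ → ℕ := fun k => Nat.rec (f v) (fun y IH => g (y ::ᵥ IH ::ᵥ v)) k
  have loop : ∀ k j, ∀ τ : ℕ → ℕ, τ = update (update (update σ m k) (m + 1) j) (m + 2) (F j) →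
      Exec (.wh m body) τ (update (update (update σ m 0) (m + 1) (j + k)) (m + 2) (F (j + k))) := by
    intro k
    induction k with
    | zero =>
      rintro j τ rfl
      exact .wh_zero (by simp)
    | succ k ih =>
      rintro j τ rfl
      refine .wh_succ (n := k) (by simp) (.seq (hd _ fun r hr => ?_)
        (.seq (.clear _ _) (.seq (.transfer (by omega) _) (.inc _ _)))) ?_
      · have := hσ r (by omega)
        simp only [Function.update_apply]; grind
      · rw [show j + (k + 1) = (j + 1) + k by omega]
        refine ih (j + 1) _ ?_
        have key : List.Vector.ofFn (update (update (update (update σ m (k + 1)) (m + 1) j) (m + 2)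
            (F j)) m k ∘ (Fin.cons (m + 1) (Fin.cons (m + 2) fun i => ins i.succ) :
              Fin (n + 2) → ℕ)) = j ::ᵥ F j ::ᵥ v := by
          refine List.Vector.ext fun i => ?_
          rw [List.Vector.get_ofFn]
          refine Fin.cases (by simp) (Fin.cases ?_ fun i => ?_) i
          · simp only [Function.comp_apply, Fin.cons_succ, Fin.cons_zero,
              List.Vector.get_cons_succ, List.Vector.get_zero, List.Vector.head_cons]
            simp
          have := hins i.succ
          simp only [Function.comp_apply, Fin.cons_succ, List.Vector.get_cons_succ, hv,
            List.Vector.get_ofFn]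
          simp only [Function.update_apply]; grind
        rw [key]
        have hF : F (j + 1) = g (j ::ᵥ F j ::ᵥ v) := rfl
        funext r
        simp only [Function.update_apply, hF]
        grind
  have hhead : (List.Vector.ofFn (σ ∘ ins)).head = σ (ins 0) := by simp [List.Vector.ofFn]
  have htail : (List.Vector.ofFn (σ ∘ ins)).tail = v := by
    simp [List.Vector.ofFn, hv]
  have hc' := hc (update σ m (σ m + σ (ins 0))) (fun r hr => by
    have := hσ r (by omega); simp only [Function.update_apply]; grind)
  have hvc : List.Vector.ofFn (update σ m (σ m + σ (ins 0)) ∘ fun i => ins (Fin.succ i)) = v := by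
    rw [hv]; congr 1; funext i; have := hins i.succ; simp only [Function.comp_apply,
      Function.update_apply]; grind
  rw [hvc] at hc'
  refine .seq (.copy (by omega) (by omega) (by omega) _ z1) (.seq hc' (.seq (loop (σ (ins 0)) 0 _ ?_)
    (.seq (.clear _ _) ?_)))
  · funext r
    have hF : F 0 = f v := rfl
    simp only [Function.update_apply, hF]; grind
  · convert Exec.transfer _ _ using 1
    · simp only [hhead, htail]
      change update σ out (σ out + F (σ (ins 0))) = _
      funext r; simp only [Function.update_apply, zero_add]; grind
    · omega

theorem Realizable.rfind {n : ℕ} {f : List.Vector ℕ (n + 1) → ℕ}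
    (hf : Realizable (f : List.Vector ℕ (n + 1) →. ℕ)) :
    Realizable fun v : List.Vector ℕ n =>
      Nat.rfind fun k => Part.some (decide (f (k ::ᵥ v) = 0)) := by
  intro ins out m hins hout hne
  obtain ⟨c, hc⟩ := hf.exists_exec (Fin.cons m ins) (m + 1) (m + 2)
    (by refine Fin.cases (by simp) fun i => ?_
        have := hins i; simp only [Fin.cons_succ]; omega) (by omega)
    (by refine Fin.cases (by simp) fun i => ?_
        have := hins i; simp only [Fin.cons_succ]; omega)
  -- Register `m` holds the candidate and `m + 1` the value of `f` there. The decrement made by the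
  -- loop is harmless, since `m + 1` is cleared at once.
  let body : Stmt := .seq (.wh (m + 1) .skip) (.seq (.inc m) c)
  refine ⟨.seq c (.seq (.wh (m + 1) body) (.wh m (.inc out))), fun σ hσ => ?_⟩
  have z0 := hσ m le_rfl
  have z1 := hσ (m + 1) (by omega)
  set v := List.Vector.ofFn (σ ∘ ins) with hv
  let S : ℕ → ℕ → ℕ → ℕ := fun k y => update (update σ m k) (m + 1) y
  have hcS : ∀ k, Exec c (S k 0) (S k (f (k ::ᵥ v))) := by
    intro k
    convert hc (S k 0) (fun r hr => by
      have := hσ r (by omega); simp only [S, Function.update_apply]; grind) using 1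
    have key : List.Vector.ofFn (S k 0 ∘ (Fin.cons m ins : Fin (n + 1) → ℕ)) = k ::ᵥ v := by
      refine List.Vector.ext fun i => ?_
      rw [List.Vector.get_ofFn]
      refine Fin.cases (by simp [S]) (fun i => ?_) i
      have := hins i
      simp only [Function.comp_apply, Fin.cons_succ, List.Vector.get_cons_succ, hv,
        List.Vector.get_ofFn]
      simp only [S, Function.update_apply]; grind
    rw [key]
    funext r; simp only [S, Function.update_apply]; grind
  have hbody : ∀ k y y', Exec body (update (S k y) (m + 1) y') (S (k + 1) (f ((k + 1) ::ᵥ v))) := by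
    intro k y y'
    refine .seq (.clear _ _) (.seq (.inc _ _) ?_)
    convert hcS (k + 1) using 1
    funext r; simp only [S, Function.update_apply]; grind
  have h0 : S 0 0 = σ := by funext r; simp only [S, Function.update_apply]; grind
  refine ⟨fun y hy => ?_, fun τ hτ => ?_⟩
  · obtain ⟨hy₁, hy₂⟩ := Nat.mem_rfind.mp hy
    have hy₁ : f (y ::ᵥ v) = 0 := by simpa using hy₁
    have hy₂ : ∀ k < y, f (k ::ᵥ v) ≠ 0 := fun k hk => by simpa using hy₂ hk
    have loop : ∀ j k, k + j = y → Exec (.wh (m + 1) body) (S k (f (k ::ᵥ v))) (S y 0) := by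
      intro j
      induction j with
      | zero =>
        intro k hk
        obtain rfl : k = y := by omega
        rw [hy₁]
        exact .wh_zero (by simp [S])
      | succ j ih =>
        intro k hk
        obtain ⟨p, hp⟩ := Nat.exists_eq_succ_of_ne_zero (hy₂ k (by omega))
        exact .wh_succ (n := p) (by simp [S, hp]) (hbody _ _ _) (ih (k + 1) (by omega))
    have h1 := hcS 0
    rw [h0] at h1
    refine .seq h1 (.seq (loop y 0 (by omega)) ?_)
    convert Exec.transfer _ _ using 1
    · funext r; simp only [S, Function.update_apply]; grind
    · omega
  · obtain ⟨τ₁, h₁, h₂⟩ := Exec.seq_iff.mp hτ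
    obtain ⟨τ₂, h₂, -⟩ := Exec.seq_iff.mp h₂
    have h1 := hcS 0
    rw [h0] at h1
    obtain rfl := h₁.deterministic h1
    -- Induction on the run: each iteration moves to the next candidate, so a terminating loop exits
    -- at a zero of `f`.
    have key : ∀ {c' ρ ρ'}, Exec c' ρ ρ' → c' = .wh (m + 1) body →
        ∀ k, ρ = S k (f (k ::ᵥ v)) → ∃ k, f (k ::ᵥ v) = 0 := by
      intro c' ρ ρ' h
      induction h with
      | skip | inc | seq => exact fun h => by cases h
      | wh_zero h =>
        rintro h' k rfl
        cases h'
        exact ⟨k, by simpa [S] using h⟩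
      | wh_succ h h₁ _ _ ih =>
        rintro h' k rfl
        cases h'
        obtain rfl := h₁.deterministic (hbody _ _ _)
        exact ih rfl _ rfl
    obtain ⟨k, hk⟩ := key h₂ rfl 0 rfl
    exact Nat.rfind_dom.mpr ⟨k, by simp [hk], fun _ => trivial⟩

theorem realizable_of_primrec' {n : ℕ} {f : List.Vector ℕ n → ℕ} (hf : Nat.Primrec' f) :
    Realizable (f : List.Vector ℕ n →. ℕ) := by
  have hget : ∀ {n} (i : Fin n), Realizable ((fun v => v.get i : List.Vector ℕ n → ℕ) :
      List.Vector ℕ n →. ℕ) := by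
    intro n i
    refine realizable_of_total fun ins out m hins hout hne =>
      ⟨.seq (.wh (ins i) (.seq (.inc out) (.inc m))) (.wh m (.inc (ins i))), fun σ hσ => ?_⟩
    rw [List.Vector.get_ofFn]
    have := hins i
    exact .copy (hne i) (by omega) (by omega) σ (hσ _ le_rfl)
  induction hf with
  | zero =>
    refine realizable_of_total fun ins out m hins hout hne => ⟨.skip, fun σ hσ => ?_⟩
    convert Exec.skip σ using 1
    simp
  | succ =>
    refine realizable_of_total fun ins out m hins hout hne => ?_
    obtain ⟨c, hc⟩ := (hget (0 : Fin 1)).exists_exec ins out m hins hout hne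
    refine ⟨.seq c (.inc out), fun σ hσ => .seq (hc σ hσ) ?_⟩
    convert Exec.inc _ _ using 1
    simp [add_assoc]
  | get i => exact hget i
  | comp g _ _ hf hg =>
    refine Eq.mp (congrArg Realizable (funext fun v => ?_)) (hf.comp hg)
    exact (congrArg (Part.bind · _) (Vector.mOfFn_part_some fun i => g i v)).trans
      (Part.bind_some _ _)
  | prec _ _ hf hg => exact hf.prec hg

theorem realizable_of_partrec' {n : ℕ} {f : List.Vector ℕ n →. ℕ} (hf : Nat.Partrec' f) :
    Realizable f := by
  induction hf with
  | prim h => exact realizable_of_primrec' h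
  | comp g _ _ hf hg => exact hf.comp hg
  | rfind _ hf => exact hf.rfind

/-- There is a program whose halting problem, for inputs in the register `0`, is undecidable. -/
theorem exists_undecidable_program :
    ∃ c : Stmt, ¬ ComputablePred fun n : ℕ => ∃ τ, Exec c (update (fun _ => 0) 0 n) τ := by
  let f : List.Vector ℕ 1 →. ℕ := fun v =>
    Nat.Partrec.Code.eval (Denumerable.ofNat Nat.Partrec.Code v.head) 0
  have hf : Partrec f := Nat.Partrec.Code.eval_part.comp
    ((Computable.ofNat _).comp Computable.vector_head) (Computable.const 0)
  obtain ⟨c, hc⟩ := realizable_of_partrec' (Nat.Partrec'.of_part hf) (fun _ => 0) 1 2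
    (fun _ => by omega) (by omega) (fun _ => by omega)
  refine ⟨c, fun h => ComputablePred.halting_problem 0 ?_⟩
  have key : ∀ n : ℕ, (∃ τ, Exec c (update (fun _ => 0) 0 n) τ) ↔
      (Nat.Partrec.Code.eval (Denumerable.ofNat Nat.Partrec.Code n) 0).Dom := by
    intro n
    obtain ⟨h₁, h₂⟩ := hc (update (fun _ => 0) 0 n) (fun r hr => by
      simp [Function.update_apply]; omega)
    have hn : f (List.Vector.ofFn (update (fun _ => 0) 0 n ∘ fun _ => 0)) =
        Nat.Partrec.Code.eval (Denumerable.ofNat Nat.Partrec.Code n) 0 := by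
      simp [f, List.Vector.ofFn]
    rw [hn] at h₁ h₂
    exact ⟨fun ⟨τ, h⟩ => h₂ τ h, fun h => ⟨_, h₁ _ (Part.get_mem h)⟩⟩
  obtain ⟨g, hg, hp⟩ := ComputablePred.computable_iff.mp h
  refine ComputablePred.computable_iff.mpr ⟨fun a => g (Encodable.encode a),
    hg.comp Computable.encode, funext fun a => ?_⟩
  have h₁ := key (Encodable.encode a)
  rw [Denumerable.ofNat_encode] at h₁
  exact (propext h₁).symm.trans (congrFun hp _)

end ModalFLew

namespace ModalFLew

open Function (update)
open Relation (ReflTransGen)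

/-! ### Simulation of programs by affine rewriting of natural numbers -/

/-- The rule that rewrites `α * s + β` to `γ * s + δ`, for every `s`. -/
structure AffineRule where
  α : ℕ
  β : ℕ
  γ : ℕ
  δ : ℕ

/-- One rewriting step with one of the rules `R`. -/
def AffineStep (R : List AffineRule) (N N' : ℕ) : Prop :=
  ∃ ρ ∈ R, ∃ s, N = ρ.α * s + ρ.β ∧ N' = ρ.γ * s + ρ.δ

/-- The rule that rewrites `u * (p * s + i)` to `v * 2 ^ (u + 1) * (p * s + i)`. -/
def mulRule (u v p i : ℕ) : AffineRule where
  α := u * p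
  β := u * i
  γ := v * 2 ^ (u + 1) * p
  δ := v * 2 ^ (u + 1) * i

/-- Rules that rewrite `u * t` to `v * 2 ^ (u + 1) * t` if `p` does not divide `t`. -/
def mulRulesNotDvd (u v p : ℕ) : List AffineRule :=
  ((List.range p).filter (0 < ·)).map (mulRule u v p)

/-- The prime number that stands for a register. -/
noncomputable def regPrime (r : ℕ) : ℕ := Nat.nth Nat.Prime (2 * r + 1)

/-- The prime number that stands for a list of programs that remain to be executed. -/
noncomputable def labelPrime (K : List Stmt) : ℕ := Nat.nth Nat.Prime (2 * Encodable.encode K + 2)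

theorem regPrime_prime (r : ℕ) : (regPrime r).Prime := Nat.prime_nth_prime _

theorem labelPrime_prime (K : List Stmt) : (labelPrime K).Prime := Nat.prime_nth_prime _

theorem nth_prime_injective : Function.Injective (Nat.nth Nat.Prime) :=
  Nat.nth_injective Nat.infinite_setOfPred_prime

theorem regPrime_inj {r s : ℕ} : regPrime r = regPrime s ↔ r = s :=
  ⟨fun h => by have := nth_prime_injective h; omega, fun h => h ▸ rfl⟩

theorem labelPrime_inj {K L : List Stmt} : labelPrime K = labelPrime L ↔ K = L :=
  ⟨fun h => Encodable.encode_injective (by have := nth_prime_injective h; omega), fun h => h ▸ rfl⟩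

theorem labelPrime_ne_regPrime (K : List Stmt) (r : ℕ) : labelPrime K ≠ regPrime r :=
  fun h => by have := nth_prime_injective h; omega

theorem two_ne_regPrime (r : ℕ) : 2 ≠ regPrime r := by
  rw [← Nat.nth_prime_zero_eq_two]
  exact fun h => by have := nth_prime_injective h; omega

theorem two_ne_labelPrime (K : List Stmt) : 2 ≠ labelPrime K := by
  rw [← Nat.nth_prime_zero_eq_two]
  exact fun h => by have := nth_prime_injective h; omega

/-- The rules that simulate the program `c`, with `K` remaining to be executed after it. -/
noncomputable def programRules : Stmt → List Stmt → List AffineRule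
  | .skip, K => [mulRule (labelPrime (.skip :: K)) (labelPrime K) 1 1]
  | .inc r, K => [mulRule (labelPrime (.inc r :: K)) (labelPrime K * regPrime r) 1 1]
  | .seq a b, K => mulRule (labelPrime (.seq a b :: K)) (labelPrime (a :: b :: K)) 1 1 ::
      (programRules a (b :: K) ++ programRules b K)
  | .wh r a, K =>
      mulRule (labelPrime (.wh r a :: K) * regPrime r) (labelPrime (a :: .wh r a :: K)) 1 1 ::
        (mulRulesNotDvd (labelPrime (.wh r a :: K)) (labelPrime K) (regPrime r) ++
          programRules a (.wh r a :: K))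

/-- The padding `2 ^ (u + 1)` exceeds `u`, whatever the labels are. The residue `i` must be nonzero
for the constant term to grow. -/
theorem mulRule_increasing {u v p i : ℕ} (hv : v ≠ 0) (hp : p ≠ 0) (hi : i ≠ 0) :
    (mulRule u v p i).α < (mulRule u v p i).γ ∧ (mulRule u v p i).β < (mulRule u v p i).δ := by
  have h : u < v * 2 ^ (u + 1) :=
    calc u < 2 ^ (u + 1) := lt_trans (Nat.lt_succ_self u) Nat.lt_two_pow_self
      _ ≤ v * 2 ^ (u + 1) := Nat.le_mul_of_pos_left _ (Nat.pos_of_ne_zero hv)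
  exact ⟨Nat.mul_lt_mul_of_pos_right h (Nat.pos_of_ne_zero hp),
    Nat.mul_lt_mul_of_pos_right h (Nat.pos_of_ne_zero hi)⟩

theorem programRules_increasing (c : Stmt) (K : List Stmt) :
    ∀ ρ ∈ programRules c K, ρ.α < ρ.γ ∧ ρ.β < ρ.δ := by
  induction c generalizing K with
  | skip =>
    simp only [programRules, List.mem_singleton, forall_eq]
    exact mulRule_increasing (labelPrime_prime _).ne_zero one_ne_zero one_ne_zero
  | inc r =>
    simp only [programRules, List.mem_singleton, forall_eq]
    exact mulRule_increasing (mul_ne_zero (labelPrime_prime _).ne_zero (regPrime_prime r).ne_zero)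
      one_ne_zero one_ne_zero
  | seq a b iha ihb =>
    simp only [programRules, List.mem_cons, List.mem_append]
    rintro ρ (rfl | h | h)
    · exact mulRule_increasing (labelPrime_prime _).ne_zero one_ne_zero one_ne_zero
    · exact iha _ _ h
    · exact ihb _ _ h
  | wh r a ih =>
    simp only [programRules, List.mem_cons, List.mem_append]
    rintro ρ (rfl | h | h)
    · exact mulRule_increasing (labelPrime_prime _).ne_zero one_ne_zero one_ne_zero
    · simp only [mulRulesNotDvd, List.mem_map, List.mem_filter, decide_eq_true_eq] at h
      obtain ⟨i, ⟨-, hi⟩, rfl⟩ := h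
      exact mulRule_increasing (labelPrime_prime _).ne_zero (regPrime_prime r).ne_zero hi.ne'
    · exact ih _ _ h

/-- With `p = i = 1` the argument `s + 1` runs through all positive `t`. -/
theorem affineStep_mulRule {R : List AffineRule} {u v t : ℕ} (h : mulRule u v 1 1 ∈ R)
    (ht : t ≠ 0) : AffineStep R (u * t) (v * 2 ^ (u + 1) * t) := by
  obtain ⟨s, rfl⟩ := Nat.exists_eq_add_one_of_ne_zero ht
  exact ⟨_, h, s, by simp only [mulRule]; ring, by simp only [mulRule]; ring⟩

theorem affineStep_mulRulesNotDvd {R : List AffineRule} {u v p t : ℕ} (hp : p ≠ 0)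
    (h : ∀ ρ ∈ mulRulesNotDvd u v p, ρ ∈ R) (ht : ¬ p ∣ t) :
    AffineStep R (u * t) (v * 2 ^ (u + 1) * t) := by
  refine ⟨mulRule u v p (t % p), h _ ?_, t / p, ?_, ?_⟩
  · simp only [mulRulesNotDvd, List.mem_map, List.mem_filter, List.mem_range, decide_eq_true_eq]
    exact ⟨_, ⟨Nat.mod_lt _ (Nat.pos_of_ne_zero hp),
      Nat.pos_of_ne_zero fun h => ht (Nat.dvd_of_mod_eq_zero h)⟩, rfl⟩
  · conv_lhs => rw [← Nat.div_add_mod t p]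
    simp only [mulRule]; ring
  · conv_lhs => rw [← Nat.div_add_mod t p]
    simp only [mulRule]; ring

theorem affineStep_append {R S : List AffineRule} {N N' : ℕ} :
    AffineStep (R ++ S) N N' ↔ AffineStep R N N' ∨ AffineStep S N N' := by
  simp only [AffineStep, List.mem_append, or_and_right, exists_or]

theorem affineStep_cons {ρ : AffineRule} {R : List AffineRule} {N N' : ℕ} :
    AffineStep (ρ :: R) N N' ↔ AffineStep [ρ] N N' ∨ AffineStep R N N' :=
  affineStep_append (R := [ρ])

theorem AffineStep.of_mulRule {u v N N' : ℕ} (h : AffineStep [mulRule u v 1 1] N N') :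
    ∃ t, N = u * t ∧ N' = v * (2 ^ (u + 1) * t) := by
  obtain ⟨ρ, hρ, s, rfl, rfl⟩ := h
  obtain rfl := List.mem_singleton.mp hρ
  exact ⟨s + 1, by simp only [mulRule]; ring, by simp only [mulRule]; ring⟩

theorem AffineStep.of_mulRulesNotDvd {u v p N N' : ℕ} (h : AffineStep (mulRulesNotDvd u v p) N N') :
    ∃ t, N = u * t ∧ N' = v * (2 ^ (u + 1) * t) ∧ ¬ p ∣ t := by
  obtain ⟨ρ, hρ, s, rfl, rfl⟩ := h
  simp only [mulRulesNotDvd, List.mem_map, List.mem_filter, List.mem_range,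
    decide_eq_true_eq] at hρ
  obtain ⟨i, ⟨hip, hi⟩, rfl⟩ := hρ
  refine ⟨p * s + i, by simp only [mulRule]; ring, by simp only [mulRule]; ring, fun hd => ?_⟩
  exact absurd (Nat.le_of_dvd hi ((Nat.dvd_add_right (dvd_mul_right p s)).mp hd)) (by omega)

/-! ### Correctness of the prime-exponent encoding -/

/-- The number `t` encodes the register contents `σ`. -/
def EncodesRegs (t : ℕ) (σ : ℕ → ℕ) : Prop :=
  t ≠ 0 ∧ (∀ K, ¬ labelPrime K ∣ t) ∧ ∀ r, t.factorization (regPrime r) = σ r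

/-- The number `N` encodes the register contents `σ`, with `K` remaining to be executed. -/
def Encodes (N : ℕ) (K : List Stmt) (σ : ℕ → ℕ) : Prop :=
  ∃ t, N = labelPrime K * t ∧ EncodesRegs t σ

namespace EncodesRegs

variable {t : ℕ} {σ : ℕ → ℕ}

theorem two_pow_mul (h : EncodesRegs t σ) (e : ℕ) : EncodesRegs (2 ^ e * t) σ := by
  refine ⟨mul_ne_zero (by positivity) h.1, fun K hK => ?_, fun r => ?_⟩
  · rcases (labelPrime_prime K).dvd_mul.mp hK with hK | hK
    · exact two_ne_labelPrime K
        ((Nat.prime_dvd_prime_iff_eq (labelPrime_prime K) Nat.prime_two).mp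
          ((labelPrime_prime K).dvd_of_dvd_pow hK)).symm
    · exact h.2.1 K hK
  · rw [Nat.factorization_mul (by positivity) h.1, Nat.prime_two.factorization_pow,
      Finsupp.add_apply, Finsupp.single_eq_of_ne (two_ne_regPrime r).symm, zero_add, h.2.2]

theorem regPrime_mul (h : EncodesRegs t σ) (r : ℕ) :
    EncodesRegs (regPrime r * t) (update σ r (σ r + 1)) := by
  refine ⟨mul_ne_zero (regPrime_prime r).ne_zero h.1, fun K hK => ?_, fun s => ?_⟩
  · rcases (labelPrime_prime K).dvd_mul.mp hK with hK | hK
    · exact labelPrime_ne_regPrime K r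
        ((Nat.prime_dvd_prime_iff_eq (labelPrime_prime K) (regPrime_prime r)).mp hK)
    · exact h.2.1 K hK
  · rw [Nat.factorization_mul (regPrime_prime r).ne_zero h.1, (regPrime_prime r).factorization,
      Finsupp.add_apply, h.2.2]
    by_cases hs : s = r
    · subst hs; simp [add_comm]
    · rw [Finsupp.single_eq_of_ne (fun h => hs (regPrime_inj.mp h)), zero_add,
        Function.update_of_ne hs]

theorem of_regPrime_mul {r : ℕ} (h : EncodesRegs (regPrime r * t) σ) :
    ∃ n, σ r = n + 1 ∧ EncodesRegs t (update σ r n) := by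
  have ht : t ≠ 0 := right_ne_zero_of_mul h.1
  have key : ∀ s, σ s = (if s = r then 1 else 0) + t.factorization (regPrime s) := by
    intro s
    rw [← h.2.2 s, Nat.factorization_mul (regPrime_prime r).ne_zero ht,
      (regPrime_prime r).factorization, Finsupp.add_apply, Finsupp.single_apply]
    simp only [regPrime_inj, eq_comm]
  refine ⟨t.factorization (regPrime r), by rw [key, if_pos rfl, add_comm], ht,
    fun K hK => h.2.1 K (hK.mul_left _), fun s => ?_⟩
  by_cases hs : s = r
  · subst hs; simp
  · rw [Function.update_of_ne hs, key, if_neg hs, zero_add]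

theorem dvd_iff (h : EncodesRegs t σ) (r : ℕ) : regPrime r ∣ t ↔ σ r ≠ 0 := by
  rw [← h.2.2 r, (regPrime_prime r).dvd_iff_one_le_factorization h.1, Nat.one_le_iff_ne_zero]

end EncodesRegs

/-- The register part has no label prime as a divisor, so the label is determined by `N`. Hence only
rules for the current label can apply. -/
theorem Encodes.of_labelPrime_mul {N t : ℕ} {K L : List Stmt} {σ : ℕ → ℕ} (h : Encodes N K σ)
    (hN : N = labelPrime L * t) : L = K ∧ EncodesRegs t σ := by
  obtain ⟨t', rfl, ht'⟩ := h
  have hd : labelPrime L ∣ labelPrime K * t' := ⟨t, hN⟩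
  rcases (labelPrime_prime L).dvd_mul.mp hd with hd | hd
  · obtain rfl : L = K := labelPrime_inj.mp
      ((Nat.prime_dvd_prime_iff_eq (labelPrime_prime L) (labelPrime_prime K)).mp hd)
    obtain rfl := Nat.eq_of_mul_eq_mul_left (labelPrime_prime L).pos hN
    exact ⟨rfl, ht'⟩
  · exact absurd hd (ht'.2.1 L)

theorem Exec.exists_rewriting {c : Stmt} {σ τ : ℕ → ℕ} (h : Exec c σ τ) (R : List AffineRule)
    (K : List Stmt) (hR : ∀ ρ ∈ programRules c K, ρ ∈ R) (N : ℕ) (hN : Encodes N (c :: K) σ) :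
    ∃ N', ReflTransGen (AffineStep R) N N' ∧ Encodes N' K τ := by
  induction h generalizing K N with
  | skip σ =>
    obtain ⟨t, rfl, ht⟩ := hN
    exact ⟨_, .single (affineStep_mulRule (hR _ (by simp [programRules])) ht.1), _,
      mul_assoc _ _ _, ht.two_pow_mul _⟩
  | inc r σ =>
    obtain ⟨t, rfl, ht⟩ := hN
    exact ⟨_, .single (affineStep_mulRule (v := labelPrime K * regPrime r)
      (hR _ (by simp [programRules])) ht.1), _, by rw [mul_assoc, mul_assoc],
      (ht.two_pow_mul _).regPrime_mul r⟩
  | @seq a b _ _ _ _ _ ih₁ ih₂ =>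
    obtain ⟨t, rfl, ht⟩ := hN
    obtain ⟨N₁, h₁, hN₁⟩ := ih₁ (b :: K) (fun ρ hρ => hR _ (by simp [programRules, hρ])) _
      ⟨_, mul_assoc _ _ _, ht.two_pow_mul _⟩
    obtain ⟨N₂, h₂, hN₂⟩ := ih₂ K (fun ρ hρ => hR _ (by simp [programRules, hρ])) _ hN₁
    exact ⟨N₂, (h₁.trans h₂).head (affineStep_mulRule (hR _ (by simp [programRules])) ht.1), hN₂⟩
  | @wh_zero r a σ h =>
    obtain ⟨t, rfl, ht⟩ := hN
    exact ⟨_, .single (affineStep_mulRulesNotDvd (regPrime_prime r).ne_zero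
      (fun ρ hρ => hR _ (by simp [programRules, hρ])) (by rw [ht.dvd_iff]; exact not_not.mpr h)), _,
      mul_assoc _ _ _, ht.two_pow_mul _⟩
  | @wh_succ r a σ τ ρ n h _ _ ih₁ ih₂ =>
    obtain ⟨t, rfl, ht⟩ := hN
    obtain ⟨t, rfl⟩ := (ht.dvd_iff r).mpr (by omega)
    obtain ⟨n', hn', ht'⟩ := ht.of_regPrime_mul
    obtain rfl : n = n' := by omega
    obtain ⟨N₁, h₁, hN₁⟩ := ih₁ (.wh r a :: K) (fun ρ hρ => hR _ (by simp [programRules, hρ])) _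
      ⟨_, mul_assoc _ _ _, ht'.two_pow_mul _⟩
    obtain ⟨N₂, h₂, hN₂⟩ := ih₂ _ hR _ hN₁
    refine ⟨N₂, (h₁.trans h₂).head ?_, hN₂⟩
    rw [← mul_assoc]
    exact affineStep_mulRule (hR _ (by simp [programRules])) ht'.1

/-- The execution of the list `K` of programs terminates. -/
def Halts : List Stmt → (ℕ → ℕ) → Prop
  | [], _ => True
  | c :: K, σ => ∃ τ, Exec c σ τ ∧ Halts K τ

/-- No spurious rewriting: a rule applicable to an encoding is one belonging to its label and
performs a genuine program step, so termination passes back along it. -/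
theorem AffineStep.exists_encodes {c : Stmt} {K L : List Stmt} {N N' : ℕ} {σ : ℕ → ℕ}
    (h : AffineStep (programRules c K) N N') (hN : Encodes N L σ) :
    ∃ L' σ', Encodes N' L' σ' ∧ (Halts L' σ' → Halts L σ) := by
  induction c generalizing K with
  | skip =>
    obtain ⟨t, h₁, rfl⟩ := AffineStep.of_mulRule h
    obtain ⟨rfl, ht⟩ := hN.of_labelPrime_mul h₁
    exact ⟨K, σ, ⟨_, rfl, ht.two_pow_mul _⟩, fun h => ⟨_, .skip _, h⟩⟩
  | inc r =>
    obtain ⟨t, h₁, rfl⟩ := AffineStep.of_mulRule h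
    obtain ⟨rfl, ht⟩ := hN.of_labelPrime_mul h₁
    exact ⟨K, _, ⟨_, mul_assoc _ _ _, (ht.two_pow_mul _).regPrime_mul r⟩,
      fun h => ⟨_, .inc _ _, h⟩⟩
  | seq a b iha ihb =>
    rw [programRules, affineStep_cons, affineStep_append] at h
    rcases h with h | h | h
    · obtain ⟨t, h₁, rfl⟩ := h.of_mulRule
      obtain ⟨rfl, ht⟩ := hN.of_labelPrime_mul h₁
      exact ⟨_, σ, ⟨_, rfl, ht.two_pow_mul _⟩, fun ⟨_, h₁, _, h₂, h₃⟩ => ⟨_, .seq h₁ h₂, h₃⟩⟩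
    · exact iha h
    · exact ihb h
  | wh r a ih =>
    rw [programRules, affineStep_cons, affineStep_append] at h
    rcases h with h | h | h
    · obtain ⟨t, h₁, rfl⟩ := h.of_mulRule
      rw [mul_assoc] at h₁
      obtain ⟨rfl, ht⟩ := hN.of_labelPrime_mul h₁
      obtain ⟨n, hn, ht⟩ := ht.of_regPrime_mul
      exact ⟨_, _, ⟨_, rfl, ht.two_pow_mul _⟩, fun ⟨_, h₁, _, h₂, h₃⟩ => ⟨_, .wh_succ hn h₁ h₂, h₃⟩⟩
    · obtain ⟨t, h₁, rfl, hd⟩ := h.of_mulRulesNotDvd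
      obtain ⟨rfl, ht⟩ := hN.of_labelPrime_mul h₁
      rw [ht.dvd_iff, not_not] at hd
      exact ⟨K, σ, ⟨_, rfl, ht.two_pow_mul _⟩, fun h => ⟨_, .wh_zero hd, h⟩⟩
    · exact ih h

theorem exists_exec_iff_rewriting (c : Stmt) {N : ℕ} {σ : ℕ → ℕ} (hN : Encodes N [c] σ) :
    (∃ τ, Exec c σ τ) ↔
      ∃ s, ReflTransGen (AffineStep (programRules c [])) N (labelPrime [] * s + labelPrime []) := by
  constructor
  · rintro ⟨τ, h⟩
    obtain ⟨N', h', t, rfl, ht⟩ := h.exists_rewriting _ [] (fun _ => id) N hN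
    obtain ⟨s, rfl⟩ := Nat.exists_eq_succ_of_ne_zero ht.1
    exact ⟨s, h'⟩
  · rintro ⟨s, h⟩
    have key : ∀ N', ReflTransGen (AffineStep (programRules c [])) N N' →
        ∃ L' σ', Encodes N' L' σ' ∧ (Halts L' σ' → Halts [c] σ) := by
      intro N' h
      induction h with
      | refl => exact ⟨_, _, hN, id⟩
      | tail _ h ih =>
        obtain ⟨L, σ', hL, h'⟩ := ih
        obtain ⟨L', σ'', hL', h''⟩ := h.exists_encodes hL
        exact ⟨L', σ'', hL', h' ∘ h''⟩
    obtain ⟨L', σ', hL', h'⟩ := key _ h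
    -- A positive multiple of `labelPrime []` can only encode the empty list, for which `Halts`
    -- holds trivially.
    obtain ⟨rfl, -⟩ := hL'.of_labelPrime_mul (L := []) (t := s + 1) (by ring)
    obtain ⟨τ, hτ, -⟩ := h' trivial
    exact ⟨τ, hτ⟩

theorem encodes_input (c : Stmt) (n : ℕ) :
    Encodes (labelPrime [c] * regPrime 0 ^ n) [c] (update (fun _ => 0) 0 n) := by
  refine ⟨_, rfl, ?_⟩
  induction n with
  | zero =>
    refine ⟨by simp, fun K h => (labelPrime_prime K).one_lt.ne' (Nat.dvd_one.mp (by simpa using h)),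
      fun r => by simp⟩
  | succ n ih =>
    have := ih.regPrime_mul 0
    rw [← pow_succ'] at this
    simpa using this

/-- A reachability problem for increasing affine rewriting rules that is undecidable. -/
theorem exists_undecidable_rewriting :
    ∃ (R : List AffineRule) (h p q : ℕ), (∀ ρ ∈ R, ρ.α < ρ.γ ∧ ρ.β < ρ.δ) ∧
      ¬ ComputablePred fun n : ℕ =>
        ∃ s, ReflTransGen (AffineStep R) (p * q ^ n) (h * s + h) := by
  obtain ⟨c, hc⟩ := exists_undecidable_program
  refine ⟨programRules c [], labelPrime [], labelPrime [c], regPrime 0,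
    programRules_increasing c [], fun h => hc ?_⟩
  convert h using 2 with n
  exact exists_exec_iff_rewriting c (encodes_input c n)

/-! ### Guessing the argument of a rule -/

/-- One step on pairs of numbers, where a pair `(N + b, b)` stands for the number `N` together with
a guess `b` for the argument of the next rule. -/
def PairStep (R : List AffineRule) (p q : ℕ × ℕ) : Prop :=
  (q.1 = p.1 + 1 ∧ q.2 = p.2 + 1) ∨
    ∃ ρ ∈ R, p.1 = (ρ.α + 1) * p.2 + ρ.β ∧
      q.1 = p.1 + ((ρ.γ - ρ.α - 1) * p.2 + (ρ.δ - ρ.β)) ∧ q.2 = 0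

theorem pairStep_incr {R : List AffineRule} (N : ℕ) (b : ℕ) :
    ReflTransGen (PairStep R) (N, 0) (N + b, b) := by
  induction b with
  | zero => exact .refl
  | succ b ih => exact ih.tail (.inl ⟨rfl, rfl⟩)

/-- The strict inequalities make the truncated subtractions genuine; the extra `- 1` drops the guess
`s` contained in the first component. -/
theorem rule_arith {ρ : AffineRule} (h : ρ.α < ρ.γ ∧ ρ.β < ρ.δ) (s : ℕ) :
    (ρ.α + 1) * s + ρ.β + ((ρ.γ - ρ.α - 1) * s + (ρ.δ - ρ.β)) = ρ.γ * s + ρ.δ := by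
  obtain ⟨k, hk⟩ := Nat.exists_eq_add_of_lt h.1
  obtain ⟨l, hl⟩ := Nat.exists_eq_add_of_lt h.2
  rw [hk, hl, show ρ.α + k + 1 - ρ.α - 1 = k by omega, show ρ.β + l + 1 - ρ.β = l + 1 by omega]
  ring

theorem rewriting_iff_pairStep {R : List AffineRule} (hR : ∀ ρ ∈ R, ρ.α < ρ.γ ∧ ρ.β < ρ.δ)
    (N h : ℕ) : (∃ s, ReflTransGen (AffineStep R) N (h * s + h)) ↔
      ∃ s, ReflTransGen (PairStep R) (N, 0) ((h + 1) * s + h, s) := by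
  constructor
  · rintro ⟨s, hs⟩
    have key : ∀ N', ReflTransGen (AffineStep R) N N' →
        ReflTransGen (PairStep R) (N, 0) (N', 0) := by
      intro N' h
      induction h with
      | refl => exact .refl
      | @tail M M' _ h ih =>
        obtain ⟨ρ, hρ, t, rfl, rfl⟩ := h
        refine (ih.trans (pairStep_incr _ t)).tail (.inr ⟨ρ, hρ, by ring, ?_, rfl⟩)
        rw [← rule_arith (hR ρ hρ)]
        ring
    refine ⟨s, (key _ hs).trans ?_⟩
    rw [show (h + 1) * s + h = h * s + h + s by ring]
    exact pairStep_incr _ s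
  · rintro ⟨s, hs⟩
    -- Invariant: the difference of the components is reachable by the original rules. Wrong guesses
    -- only block rule applications.
    have key : ∀ p, ReflTransGen (PairStep R) (N, 0) p →
        ∃ N', ReflTransGen (AffineStep R) N N' ∧ p.1 = N' + p.2 := by
      intro p h
      induction h with
      | refl => exact ⟨N, .refl, rfl⟩
      | @tail p q _ h ih =>
        obtain ⟨N', hN', hp⟩ := ih
        rcases h with ⟨h₁, h₂⟩ | ⟨ρ, hρ, h₁, h₂, h₃⟩
        · exact ⟨N', hN', by omega⟩
        · refine ⟨_, hN'.tail ⟨ρ, hρ, p.2, ?_, rfl⟩, ?_⟩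
          · have : (ρ.α + 1) * p.2 = ρ.α * p.2 + p.2 := by ring
            omega
          · rw [h₂, h₁, h₃, rule_arith (hR ρ hρ), add_zero]
    obtain ⟨N', hN', hp⟩ := key _ hs
    refine ⟨s, ?_⟩
    have : (h + 1) * s = h * s + s := by ring
    simp only at hp
    rwa [show h * s + h = N' by omega]

end ModalFLew

namespace ModalFLew

open Relation (ReflTransGen)

/-! ### Arithmetic of `FLew`-algebras -/

namespace FLew

variable {A : Type*} [FLew A]

theorem le_one (a : A) : a ≤ 1 := by rw [one_eq_top]; exact le_top

theorem one_le_iff {a : A} : 1 ≤ a ↔ a = 1 := ⟨fun h => le_antisymm (le_one a) h, fun h => h.ge⟩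

theorem mul_le_mul_right' {a b : A} (h : a ≤ b) (c : A) : a * c ≤ b * c :=
  (mul_le_iff_le_himp _ _ _).mpr (h.trans ((mul_le_iff_le_himp _ _ _).mp le_rfl))

theorem mul_le_mul'' {a b c d : A} (h : a ≤ b) (h' : c ≤ d) : a * c ≤ b * d :=
  (mul_le_mul_right' h c).trans (by rw [mul_comm b, mul_comm b]; exact mul_le_mul_right' h' b)

theorem mul_le_left (a b : A) : a * b ≤ a := by
  simpa using mul_le_mul'' (le_refl a) (le_one b)

theorem mul_le_right (a b : A) : a * b ≤ b := by rw [mul_comm]; exact mul_le_left b a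

theorem himp_eq_one_iff {a b : A} : a ⇨ b = 1 ↔ a ≤ b := by
  rw [← one_le_iff, ← mul_le_iff_le_himp, one_mul]

theorem one_himp (a : A) : (1 : A) ⇨ a = a :=
  le_antisymm (by simpa using (mul_le_iff_le_himp (1 ⇨ a) 1 a).mpr le_rfl)
    ((mul_le_iff_le_himp _ _ _).mp (by rw [mul_one]))

theorem himp_mul_le (a b : A) : (a ⇨ b) * a ≤ b := (mul_le_iff_le_himp _ _ _).mpr le_rfl

theorem inf_eq_one_iff {a b : A} : a ⊓ b = 1 ↔ a = 1 ∧ b = 1 := by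
  rw [← one_le_iff, le_inf_iff, one_le_iff, one_le_iff]

theorem biimp_eq_one_iff {a b : A} : (a ⇨ b) ⊓ (b ⇨ a) = 1 ↔ a = b := by
  rw [inf_eq_one_iff, himp_eq_one_iff, himp_eq_one_iff, le_antisymm_iff]

theorem pow_le_pow_of_le {m n : ℕ} (h : m ≤ n) (a : A) : a ^ n ≤ a ^ m := by
  obtain ⟨k, rfl⟩ := Nat.exists_eq_add_of_le h
  rw [pow_add]
  exact mul_le_left _ _

theorem pow_le_self {n : ℕ} (h : n ≠ 0) (a : A) : a ^ n ≤ a := by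
  simpa using pow_le_pow_of_le (Nat.one_le_iff_ne_zero.mpr h) a

/-- Powers decrease, so a coincidence at two exponents makes the sequence constant from the smaller
one to the next, and multiplication by `a` then no longer changes the common value. -/
theorem eq_or_saturated_of_pow_eq {a : A} {m n : ℕ} (h : a ^ m = a ^ n) :
    m = n ∨ a ^ m * a = a ^ m := by
  rcases lt_trichotomy m n with hmn | hmn | hmn
  · refine .inr (le_antisymm (mul_le_left _ _) ?_)
    rw [← pow_succ]
    exact h.le.trans (pow_le_pow_of_le hmn a)
  · exact .inl hmn
  · right
    have hn : a ^ n * a = a ^ n := by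
      refine le_antisymm (mul_le_left _ _) ?_
      rw [← pow_succ]
      exact h.ge.trans (pow_le_pow_of_le hmn a)
    rw [h, hn]

/-- For `m < n`, already `a ^ m ⇨ a ^ n` suffices. For `n < m`, split off `a ^ n` from `a ^ m`: the
other implication turns it into `a ^ m`, leaving at least one factor `a`. -/
theorem himp_le_himp_pow_mul {a : A} {m n : ℕ} (h : m ≠ n) :
    (a ^ m ⇨ a ^ n) ⊓ (a ^ n ⇨ a ^ m) ≤ a ^ m ⇨ a ^ m * a := by
  rw [← mul_le_iff_le_himp]
  rcases lt_or_gt_of_ne h with h | h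
  · refine (mul_le_mul_right' inf_le_left _).trans ((himp_mul_le _ _).trans ?_)
    rw [← pow_succ]
    exact pow_le_pow_of_le h a
  · obtain ⟨k, rfl⟩ := Nat.exists_eq_add_of_lt h
    refine (mul_le_mul_right' inf_le_right _).trans ?_
    calc (a ^ n ⇨ a ^ (n + k + 1)) * a ^ (n + k + 1)
        = (a ^ n ⇨ a ^ (n + k + 1)) * a ^ n * a ^ (k + 1) := by
          rw [mul_assoc, ← pow_add, add_assoc]
      _ ≤ a ^ (n + k + 1) * a := mul_le_mul'' (himp_mul_le _ _) (pow_le_self k.succ_ne_zero a)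

end FLew

/-! ### Values of formulas -/

namespace Fm

/-- The biconditional. -/
def iff (φ ψ : Fm) : Fm := and (imp φ ψ) (imp ψ φ)

/-- The `n`-fold product of a formula with itself. -/
def pow (φ : Fm) : ℕ → Fm
  | 0 => one
  | n + 1 => mul (φ.pow n) φ

end Fm

namespace Model

variable {M : Model.{u, v}}

theorem eval_mul (φ ψ : Fm) (w : M.frame.World) :
    M.eval (φ.mul ψ) w = M.eval φ w * M.eval ψ w := rfl

theorem eval_pow (φ : Fm) (n : ℕ) (w : M.frame.World) :
    M.eval (φ.pow n) w = M.eval φ w ^ n := by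
  induction n with
  | zero => simp [Fm.pow, eval]
  | succ n ih => rw [Fm.pow, eval_mul, ih, pow_succ]

theorem eval_iff (φ ψ : Fm) (w : M.frame.World) : M.eval (φ.iff ψ) w =
    (M.eval φ w ⇨ M.eval ψ w) ⊓ (M.eval ψ w ⇨ M.eval φ w) := rfl

theorem eval_iff_eq_one {φ ψ : Fm} {w : M.frame.World} :
    M.eval (φ.iff ψ) w = 1 ↔ M.eval φ w = M.eval ψ w := FLew.biimp_eq_one_iff

theorem eval_and_eq_one {φ ψ : Fm} {w : M.frame.World} :
    M.eval (φ.and ψ) w = 1 ↔ M.eval φ w = 1 ∧ M.eval ψ w = 1 := FLew.inf_eq_one_iff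

theorem eval_imp_eq_one {φ ψ : Fm} {w : M.frame.World} :
    M.eval (φ.imp ψ) w = 1 ↔ M.eval φ w ≤ M.eval ψ w := FLew.himp_eq_one_iff

theorem eval_or_eq_one (hM : M.alg.IsChain) {φ ψ : Fm} {w : M.frame.World} :
    M.eval (φ.or ψ) w = 1 ↔ M.eval φ w = 1 ∨ M.eval ψ w = 1 := by
  change M.eval φ w ⊔ M.eval ψ w = 1 ↔ _
  constructor
  · intro h
    rcases hM (M.eval φ w) (M.eval ψ w) with h' | h'
    · exact .inr (by rwa [sup_eq_right.mpr h'] at h)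
    · exact .inl (by rwa [sup_eq_left.mpr h'] at h)
  · rintro (h | h)
    · exact FLew.one_le_iff.mp (h ▸ le_sup_left)
    · exact FLew.one_le_iff.mp (h ▸ le_sup_right)

theorem isGLB_eval_box (hM : M.Safe) (φ : Fm) (w : M.frame.World) :
    IsGLB (M.eval φ '' {w' | M.frame.rel w w'}) (M.eval φ.box w) := by
  have h := (hM φ w).1
  simp only [eval, dif_pos h]
  exact h.choose_spec

theorem isLUB_eval_dia (hM : M.Safe) (φ : Fm) (w : M.frame.World) :
    IsLUB (M.eval φ '' {w' | M.frame.rel w w'}) (M.eval φ.dia w) := by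
  have h := (hM φ w).2
  simp only [eval, dif_pos h]
  exact h.choose_spec

theorem eval_box_eq_one_of_forall_not_rel (hM : M.Safe) {w : M.frame.World}
    (h : ∀ w', ¬ M.frame.rel w w') (φ : Fm) : M.eval φ.box w = 1 :=
  FLew.one_le_iff.mp ((isGLB_eval_box hM φ w).2 (by
    rintro _ ⟨w', hw', -⟩
    exact absurd hw' (h w')))

theorem eval_box_zero_of_rel (hM : M.Safe) {w w' : M.frame.World} (h : M.frame.rel w w') :
    M.eval Fm.zero.box w = ⊥ :=
  le_bot_iff.mp ((isGLB_eval_box hM .zero w).1 ⟨w', h, rfl⟩)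

/-- Supremum below infimum forces equal values at all successors, so an arbitrary successor can
serve as the predecessor configuration. -/
theorem eval_box_eq_of_dia_le_box (hM : M.Safe) {φ : Fm} {w w' : M.frame.World}
    (h : M.frame.rel w w') (hφ : M.eval φ.dia w ≤ M.eval φ.box w) :
    M.eval φ.box w = M.eval φ w' :=
  le_antisymm ((isGLB_eval_box hM φ w).1 ⟨w', h, rfl⟩)
    (((isLUB_eval_dia hM φ w).1 ⟨w', h, rfl⟩).trans hφ)

theorem image_eval_of_unique_successor {w w' : M.frame.World}
    (h : ∀ w'', M.frame.rel w w'' ↔ w'' = w') (φ : Fm) :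
    M.eval φ '' {w'' | M.frame.rel w w''} = {M.eval φ w'} := by
  simp [h]

theorem eval_box_of_unique_successor (hM : M.Safe) {w w' : M.frame.World}
    (h : ∀ w'', M.frame.rel w w'' ↔ w'' = w') (φ : Fm) : M.eval φ.box w = M.eval φ w' := by
  have := isGLB_eval_box hM φ w
  rw [image_eval_of_unique_successor h] at this
  exact this.unique isGLB_singleton

theorem eval_dia_of_unique_successor (hM : M.Safe) {w w' : M.frame.World}
    (h : ∀ w'', M.frame.rel w w'' ↔ w'' = w') (φ : Fm) : M.eval φ.dia w = M.eval φ w' := by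
  have := isLUB_eval_dia hM φ w
  rw [image_eval_of_unique_successor h] at this
  exact this.unique isLUB_singleton

theorem safe_of_subsingleton_successors
    (h : ∀ w w₁ w₂, M.frame.rel w w₁ → M.frame.rel w w₂ → w₁ = w₂) : M.Safe := by
  intro φ w
  by_cases hw : ∃ w', M.frame.rel w w'
  · obtain ⟨w', hw'⟩ := hw
    rw [image_eval_of_unique_successor fun w'' => ⟨fun h' => h _ _ _ h' hw', fun e => e ▸ hw'⟩]
    exact ⟨⟨_, isGLB_singleton⟩, ⟨_, isLUB_singleton⟩⟩
  · have : {w' | M.frame.rel w w'} = ∅ := Set.eq_empty_of_forall_notMem fun w' h' => hw ⟨w', h'⟩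
    rw [this, Set.image_empty]
    exact ⟨⟨⊤, isGLB_empty⟩, ⟨⊥, isLUB_empty⟩⟩

end Model

/-! ### The formulas that describe the rewriting -/

section Formulas

variable (x y z : ℕ)

/-- The formula `¬ □ 0`. -/
def hasSuccFm : Fm := .imp (.box .zero) .zero

/-- All successors agree on the three variables, and the last one is constant. -/
def agreeFm : Fm :=
  .imp hasSuccFm
    (.and (.and (.imp (.dia (.var x)) (.box (.var x))) (.imp (.dia (.var y)) (.box (.var y))))
      (.and (.imp (.dia (.var z)) (.box (.var z))) (.iff (.var z) (.box (.var z)))))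

/-- Worlds without successors carry the pair `(N, 0)`. -/
def startFm (N : ℕ) : Fm :=
  .imp (.box .zero) (.and (.iff (.var x) (.pow (.var z) N)) (.var y))

/-- Both components are increased by one. -/
def incrFm : Fm :=
  .and (.iff (.var x) (.mul (.box (.var x)) (.var z)))
    (.iff (.var y) (.mul (.box (.var y)) (.var z)))

/-- The rule `ρ` is applied. -/
def ruleFm (ρ : AffineRule) : Fm :=
  .and (.iff (.box (.var x)) (.mul (.pow (.box (.var y)) (ρ.α + 1)) (.pow (.var z) ρ.β)))
    (.and (.iff (.var x) (.mul (.box (.var x))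
      (.mul (.pow (.box (.var y)) (ρ.γ - ρ.α - 1)) (.pow (.var z) (ρ.δ - ρ.β))))) (.var y))

/-- One of the steps with the rules `R` is made. -/
def someStepFm (R : List AffineRule) : Fm :=
  R.foldr (fun ρ φ => .or (ruleFm x y z ρ) φ) (incrFm x y z)

/-- Worlds with successors result from these by a step with the rules `R`. -/
def stepFm (R : List AffineRule) : Fm := .imp hasSuccFm (someStepFm x y z R)

/-- The formula that fails at pairs of the form `((h + 1) * s + h, s)`. -/
def goalFm (h : ℕ) : Fm :=
  .imp (.iff (.var x) (.mul (.pow (.var y) (h + 1)) (.pow (.var z) h)))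
    (.imp (.var x) (.mul (.var x) (.var z)))

/-- The premises that describe the rewriting with the rules `R` from `N`. -/
def premises (R : List AffineRule) (N : ℕ) : List Fm :=
  [agreeFm x y z, startFm x y z N, stepFm x y z R]

end Formulas

/-! ### Unreachability implies the consequence -/

namespace Model

variable {M : Model.{u, v}} {x y z : ℕ}

theorem eval_someStepFm (hM : M.alg.IsChain) (R : List AffineRule) (w : M.frame.World) :
    M.eval (someStepFm x y z R) w = 1 ↔
      M.eval (incrFm x y z) w = 1 ∨ ∃ ρ ∈ R, M.eval (ruleFm x y z ρ) w = 1 := by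
  induction R with
  | nil => simp [someStepFm]
  | cons ρ R ih =>
    rw [someStepFm, List.foldr_cons, eval_or_eq_one hM, ← someStepFm, ih]
    simp only [List.mem_cons, exists_eq_or_imp]
    tauto

theorem eval_hasSuccFm_of_rel (hM : M.Safe) {w w' : M.frame.World} (h : M.frame.rel w w') :
    M.eval hasSuccFm w = 1 :=
  eval_imp_eq_one.mpr (by rw [eval_box_zero_of_rel hM h]; exact bot_le)

theorem eval_of_eval_hasSucc_imp (hM : M.Safe) {w w' : M.frame.World} (h : M.frame.rel w w')
    {φ : Fm} (hφ : M.eval (.imp hasSuccFm φ) w = 1) : M.eval φ w = 1 := by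
  rw [eval_imp_eq_one, eval_hasSuccFm_of_rel hM h] at hφ
  exact FLew.one_le_iff.mp hφ

theorem eval_hasSucc_imp_of_forall_not_rel (hM : M.Safe) {w : M.frame.World}
    (h : ∀ w', ¬ M.frame.rel w w') (φ : Fm) : M.eval (.imp hasSuccFm φ) w = 1 := by
  have : M.eval hasSuccFm w = ⊥ := by
    change M.eval Fm.zero.box w ⇨ ⊥ = ⊥
    rw [eval_box_eq_one_of_forall_not_rel hM h, FLew.one_himp]
  rw [eval_imp_eq_one, this]
  exact bot_le

/-- The values of the variables at a world, if the premises hold. -/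
theorem eval_cases_of_premises (hc : M.alg.IsChain) (hM : M.Safe) {R : List AffineRule} {N : ℕ}
    (hΓ : ∀ γ ∈ premises x y z R N, M.Satisfies γ) (w : M.frame.World) :
    (M.val w x = M.val w z ^ N ∧ M.val w y = 1) ∨
    ∃ w', M.val w' z = M.val w z ∧
      ((M.val w x = M.val w' x * M.val w z ∧ M.val w y = M.val w' y * M.val w z) ∨
      ∃ ρ ∈ R, M.val w' x = M.val w' y ^ (ρ.α + 1) * M.val w z ^ ρ.β ∧
        M.val w x = M.val w' x *
          (M.val w' y ^ (ρ.γ - ρ.α - 1) * M.val w z ^ (ρ.δ - ρ.β)) ∧ M.val w y = 1) := by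
  simp only [premises, List.mem_cons, List.not_mem_nil, or_false, forall_eq_or_imp,
    forall_eq] at hΓ
  obtain ⟨h₁, h₂, h₃⟩ := hΓ
  by_cases hw : ∃ w', M.frame.rel w w'
  · obtain ⟨w', hw'⟩ := hw
    right
    have h₁ := eval_of_eval_hasSucc_imp hM hw' (h₁ w)
    have h₃ := eval_of_eval_hasSucc_imp hM hw' (h₃ w)
    simp only [eval_and_eq_one, eval_imp_eq_one, eval_iff_eq_one] at h₁
    obtain ⟨⟨hx, hy⟩, hz, hz'⟩ := h₁
    have hx := eval_box_eq_of_dia_le_box hM hw' hx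
    have hy := eval_box_eq_of_dia_le_box hM hw' hy
    have hz := eval_box_eq_of_dia_le_box hM hw' hz
    refine ⟨w', (hz'.trans hz).symm, ?_⟩
    rw [eval_someStepFm hc] at h₃
    simp only [incrFm, ruleFm, eval_and_eq_one, eval_iff_eq_one] at h₃
    rcases h₃ with ⟨h, h'⟩ | ⟨ρ, hρ, h, h', h''⟩
    · left
      simp only [eval_mul, hx, hy] at h h'
      exact ⟨h, h'⟩
    · right
      simp only [eval_mul, eval_pow, hx, hy] at h h'
      exact ⟨ρ, hρ, h, h', h''⟩
  · left
    have h₂ := h₂ w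
    rw [startFm, eval_imp_eq_one,
      eval_box_eq_one_of_forall_not_rel hM fun w' h => hw ⟨w', h⟩, FLew.one_le_iff,
      eval_and_eq_one, eval_iff_eq_one, eval_pow] at h₂
    exact h₂

/-- Induction on `n` along successors, without any well-foundedness of the frame. Reachability and
saturation are inherited from a successor, and the bound gains one factor `z` per step; infinite
paths end up in the third case for every `n`. -/
theorem saturated_or_reachable_or_le (hc : M.alg.IsChain) (hM : M.Safe) {R : List AffineRule}
    (hR : ∀ ρ ∈ R, ρ.α < ρ.γ ∧ ρ.β < ρ.δ) {N : ℕ}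
    (hΓ : ∀ γ ∈ premises x y z R N, M.Satisfies γ) (n : ℕ) (w : M.frame.World) :
    M.val w x * M.val w z = M.val w x ∨
    (∃ p, ReflTransGen (PairStep R) (N, 0) p ∧ M.val w x = M.val w z ^ p.1 ∧
      M.val w y = M.val w z ^ p.2) ∨
    M.val w x ≤ M.val w z ^ n := by
  induction n generalizing w with
  | zero => exact .inr (.inr (by rw [pow_zero]; exact FLew.le_one _))
  | succ n ih =>
    rcases eval_cases_of_premises hc hM hΓ w with ⟨hx, hy⟩ | ⟨w', hz, h⟩
    · exact .inr (.inl ⟨_, .refl, hx, by rw [hy, pow_zero]⟩)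
    -- In the rule case, `β < δ` guarantees at least one factor `z`.
    · have hu : ∃ u, M.val w x = M.val w' x * u ∧ u ≤ M.val w z := by
        rcases h with ⟨h, -⟩ | ⟨ρ, hρ, -, h, -⟩
        · exact ⟨_, h, le_rfl⟩
        · have := (hR ρ hρ).2
          exact ⟨_, h, (FLew.mul_le_right _ _).trans (FLew.pow_le_self (by omega) _)⟩
      obtain ⟨u, hu, huz⟩ := hu
      have hsat : M.val w' x * M.val w z = M.val w' x → M.val w x * M.val w z = M.val w x := by
        intro h
        rw [hu, mul_right_comm, h]
      have ih := ih w'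
      rw [hz] at ih
      rcases ih with ih | ⟨p, hp, hpx, hpy⟩ | ih
      · exact .inl (hsat ih)
      · rcases h with ⟨h₁, h₂⟩ | ⟨ρ, hρ, h₁, h₂, h₃⟩
        · exact .inr (.inl ⟨(p.1 + 1, p.2 + 1), hp.tail (.inl ⟨rfl, rfl⟩),
            by rw [h₁, hpx, pow_succ], by rw [h₂, hpy, pow_succ]⟩)
        · rw [hpy, ← pow_mul', ← pow_add, hpx] at h₁
          -- The premise only equates powers of `z`: either the exponents agree and the rule really
          -- applies, or the powers have stabilised.
          rcases FLew.eq_or_saturated_of_pow_eq h₁ with h₁ | h₁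
          · refine .inr (.inl ⟨(_, _), hp.tail (.inr ⟨ρ, hρ, h₁, rfl, rfl⟩), ?_, by
              rw [h₃, pow_zero]⟩)
            rw [h₂, hpx, hpy, ← pow_mul', ← pow_add, ← pow_add]
          · exact .inl (hsat (by rw [hpx, h₁]))
      · refine .inr (.inr ?_)
        rw [hu, pow_succ]
        exact FLew.mul_le_mul'' ih huz

theorem satisfies_goalFm (hc : M.alg.IsChain) (hs : M.alg.IsWeaklySaturated) (hM : M.Safe)
    {R : List AffineRule} (hR : ∀ ρ ∈ R, ρ.α < ρ.γ ∧ ρ.β < ρ.δ) {N h : ℕ}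
    (hN : ¬ ∃ s, ReflTransGen (PairStep R) (N, 0) ((h + 1) * s + h, s))
    (hΓ : ∀ γ ∈ premises x y z R N, M.Satisfies γ) : M.Satisfies (goalFm x y z h) := by
  intro w
  rw [goalFm, eval_imp_eq_one]
  by_cases hsat : M.val w x * M.val w z = M.val w x
  · refine (FLew.le_one _).trans (eval_imp_eq_one.mpr ?_).ge
    exact hsat.ge
  by_cases hr : ∃ p, ReflTransGen (PairStep R) (N, 0) p ∧ M.val w x = M.val w z ^ p.1 ∧
      M.val w y = M.val w z ^ p.2
  · obtain ⟨⟨a, b⟩, hp, hx, hy⟩ := hr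
    have hab : a ≠ (h + 1) * b + h := by
      rintro rfl
      exact hN ⟨b, hp⟩
    rw [eval_iff]
    simp only [eval, eval_pow]
    rw [hy, hx, ← pow_mul', ← pow_add]
    exact FLew.himp_le_himp_pow_mul hab
  · refine absurd (hs _ _ fun n => ?_) hsat
    rcases saturated_or_reachable_or_le hc hM hR hΓ n w with h | h | h
    · exact absurd h hsat
    · exact absurd h hr
    · exact h

end Model

/-! ### Countermodels from rewriting paths -/

theorem exists_path_of_reflTransGen {α : Type*} {r : α → α → Prop} {a b : α}
    (h : ReflTransGen r a b) :
    ∃ (k : ℕ) (f : ℕ → α), f 0 = b ∧ f k = a ∧ ∀ i < k, r (f (i + 1)) (f i) := by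
  induction h with
  | refl => exact ⟨0, fun _ => a, rfl, rfl, by simp⟩
  | @tail b c _ hbc ih =>
    obtain ⟨k, f, h₀, hk, hf⟩ := ih
    refine ⟨k + 1, fun i => Nat.casesOn i c f, rfl, hk, fun i hi => ?_⟩
    cases i with
    | zero => simpa [h₀] using hbc
    | succ i => exact hf i (by omega)

namespace Model

variable {M : Model.{u, v}} {x y z : ℕ}

/-- The premises hold in models whose worlds form a path that carries, in the exponents of the
values of the variables, a sequence of steps with the rules. -/
theorem satisfies_premises (hc : M.alg.IsChain) (hM : M.Safe) {c : M.alg} {k N : ℕ}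
    {f : ℕ → ℕ × ℕ} {R : List AffineRule} (hk : f k = (N, 0))
    (hf : ∀ i < k, PairStep R (f (i + 1)) (f i)) (d : M.frame.World → ℕ)
    (hd : ∀ w, d w = k ∧ (∀ w', ¬ M.frame.rel w w') ∨
      d w < k ∧ ∃ w', d w' = d w + 1 ∧ ∀ w'', M.frame.rel w w'' ↔ w'' = w')
    (hx : ∀ w, M.val w x = c ^ (f (d w)).1) (hy : ∀ w, M.val w y = c ^ (f (d w)).2)
    (hz : ∀ w, M.val w z = c) : ∀ γ ∈ premises x y z R N, M.Satisfies γ := by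
  have hx' : ∀ w, M.eval (.var x) w = c ^ (f (d w)).1 := hx
  have hy' : ∀ w, M.eval (.var y) w = c ^ (f (d w)).2 := hy
  have hz' : ∀ w, M.eval (.var z) w = c := hz
  have key : ∀ w : M.frame.World, M.eval (agreeFm x y z) w = 1 ∧
      M.eval (startFm x y z N) w = 1 ∧ M.eval (stepFm x y z R) w = 1 := by
    intro w
    rcases hd w with ⟨hw, hw'⟩ | ⟨hw, w', hdw', hw'⟩
    · refine ⟨eval_hasSucc_imp_of_forall_not_rel hM hw' _, ?_,
        eval_hasSucc_imp_of_forall_not_rel hM hw' _⟩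
      rw [startFm, eval_imp_eq_one]
      refine (FLew.le_one _).trans (FLew.one_le_iff.mpr ?_)
      rw [eval_and_eq_one, eval_iff_eq_one, eval_pow, hx', hy', hz', hw, hk]
      exact ⟨rfl, pow_zero c⟩
    · have hbox := eval_box_of_unique_successor hM hw'
      have hdia := eval_dia_of_unique_successor hM hw'
      refine ⟨?_, ?_, ?_⟩
      · rw [agreeFm, eval_imp_eq_one]
        refine (FLew.le_one _).trans (FLew.one_le_iff.mpr ?_)
        simp only [eval_and_eq_one, eval_imp_eq_one, eval_iff_eq_one, hbox, hdia, hz', le_refl,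
          and_true]
      · rw [startFm, eval_imp_eq_one, hbox]
        exact bot_le
      · rw [stepFm, eval_imp_eq_one]
        refine (FLew.le_one _).trans (FLew.one_le_iff.mpr ?_)
        rw [eval_someStepFm hc]
        simp only [incrFm, ruleFm, eval_and_eq_one, eval_iff_eq_one, eval_mul, eval_pow, hbox, hx',
          hy', hz', hdw']
        rcases hf _ hw with ⟨h₁, h₂⟩ | ⟨ρ, hρ, h₁, h₂, h₃⟩
        · left
          rw [h₁, h₂, pow_succ, pow_succ]
          exact ⟨rfl, rfl⟩
        · refine .inr ⟨ρ, hρ, ?_, ?_, ?_⟩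
          · rw [← pow_mul', ← pow_add, ← h₁]
          · rw [← pow_mul', ← pow_add, ← pow_add, ← h₂]
          · rw [h₃, pow_zero]
  simp only [premises, List.mem_cons, List.not_mem_nil, or_false, forall_eq_or_imp, forall_eq]
  exact ⟨fun w => (key w).1, fun w => (key w).2.1, fun w => (key w).2.2⟩

/-- At a target pair the antecedent of the goal has value 1, so the goal would force contraction at
this exponent. -/
theorem pow_succ_eq_of_eval_goalFm {w : M.frame.World} {h s : ℕ} {c : M.alg}
    (hx : M.val w x = c ^ ((h + 1) * s + h)) (hy : M.val w y = c ^ s) (hz : M.val w z = c)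
    (hg : M.eval (goalFm x y z h) w = 1) : c ^ ((h + 1) * s + h + 1) = c ^ ((h + 1) * s + h) := by
  have hx' : M.eval (.var x) w = c ^ ((h + 1) * s + h) := hx
  have hy' : M.eval (.var y) w = c ^ s := hy
  have hz' : M.eval (.var z) w = c := hz
  rw [goalFm, eval_imp_eq_one, eval_iff_eq_one.mpr, FLew.one_le_iff, eval_imp_eq_one, eval_mul,
    hx', hz'] at hg
  · exact le_antisymm (FLew.pow_le_pow_of_le (Nat.le_succ _) c) (by rwa [pow_succ])
  · rw [eval_mul, eval_pow, eval_pow, hx', hy', hz', ← pow_mul', ← pow_add]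

end Model

/-- The chain with the worlds `0, …, k`. -/
def chainFrame (k : ℕ) : Frame.{u} where
  World := ULift (Fin (k + 1))
  rel i j := (j.down : ℕ) = (i.down : ℕ) + 1

theorem chainFrame_mem (k : ℕ) : chainFrame.{u} k ∈ chainFrames :=
  ⟨k, ⟨Equiv.ulift, Iff.rfl⟩⟩

/-- The model on a chain that assigns the powers of `c` with the exponents `f i` to the variables
`x` and `y`, and `c` to the others. -/
def chainModel (A : Alg.{v}) (c : A) (k : ℕ) (f : ℕ → ℕ × ℕ) (x y : ℕ) : Model.{u, v} where
  alg := A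
  frame := chainFrame k
  val w i := if i = x then c ^ (f w.down).1 else if i = y then c ^ (f w.down).2 else c

theorem chainModel_safe (A : Alg.{v}) (c : A) (k : ℕ) (f : ℕ → ℕ × ℕ) (x y : ℕ) :
    (chainModel.{u, v} A c k f x y).Safe :=
  Model.safe_of_subsingleton_successors fun _ _ _ h₁ h₂ =>
    ULift.ext _ _ (Fin.ext (h₁.trans h₂.symm))

theorem chainModel_satisfies (A : Alg.{v}) (hA : A.IsChain) (c : A) {x y z : ℕ} (hxy : x ≠ y)
    (hxz : x ≠ z) (hyz : y ≠ z) {k N : ℕ} {f : ℕ → ℕ × ℕ} {R : List AffineRule}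
    (hk : f k = (N, 0)) (hf : ∀ i < k, PairStep R (f (i + 1)) (f i)) :
    ∀ γ ∈ premises x y z R N, (chainModel.{u, v} A c k f x y).Satisfies γ := by
  refine Model.satisfies_premises hA (chainModel_safe A c k f x y) (c := c) hk hf
    (fun w => (ULift.down w : Fin (k + 1))) (fun w => ?_) (fun w => if_pos rfl)
    (fun w => (if_neg hxy.symm).trans (if_pos rfl))
    (fun w => (if_neg hxz.symm).trans (if_neg hyz.symm))
  obtain ⟨i⟩ := w
  have hi := i.2
  by_cases hik : (i : ℕ) < k
  · exact .inr ⟨hik, ⟨⟨i + 1, by omega⟩⟩, rfl,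
      fun w'' => ⟨fun h => ULift.ext _ _ (Fin.ext h), fun h => h ▸ rfl⟩⟩
  · refine .inl ⟨by change (i : ℕ) = k; omega, fun w' h => ?_⟩
    have h' : ((ULift.down w' : Fin (k + 1)) : ℕ) = i + 1 := h
    have := (ULift.down w' : Fin (k + 1)).2
    omega

/-- The global consequence that expresses a reachability problem. -/
theorem globallyFollows_iff {𝒜 : Set Alg.{v}} {𝒞 : Set Model.{u, v}}
    (h𝒜 : ∀ A ∈ 𝒜, A.IsChain ∧ A.IsWeaklySaturated) (hn : ∀ n : ℕ, ∃ A ∈ 𝒜, ¬ A.IsContractive n)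
    (h𝒞 : ∀ M ∈ 𝒞, M.alg ∈ 𝒜 ∧ M.Safe)
    (hL : ∀ M : Model.{u, v}, M.alg ∈ 𝒜 → M.Safe → M.frame ∈ chainFrames → M ∈ 𝒞)
    {x y z : ℕ} (hxy : x ≠ y) (hxz : x ≠ z) (hyz : y ≠ z) {R : List AffineRule}
    (hR : ∀ ρ ∈ R, ρ.α < ρ.γ ∧ ρ.β < ρ.δ) (N h : ℕ) :
    GloballyFollows 𝒞 {γ | γ ∈ premises x y z R N} (goalFm x y z h) ↔
      ¬ ∃ s, ReflTransGen (PairStep R) (N, 0) ((h + 1) * s + h, s) := by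
  constructor
  · rintro hf ⟨s, hs⟩
    obtain ⟨k, f, h₀, hk, hstep⟩ := exists_path_of_reflTransGen hs
    -- The algebra depends on the target reached: non-contractivity is needed exactly at its
    -- exponent.
    obtain ⟨A, hA, hcontr⟩ := hn ((h + 1) * s + h)
    obtain ⟨c, hc⟩ := not_forall.mp hcontr
    have hg := hf (chainModel A c k f x y) (hL _ hA (chainModel_safe A c k f x y) (chainFrame_mem k))
      (chainModel_satisfies A (h𝒜 A hA).1 c hxy hxz hyz hk hstep) ⟨0⟩
    refine hc (Model.pow_succ_eq_of_eval_goalFm ?_ ?_ ?_ hg)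
    · exact (if_pos rfl).trans (congrArg (fun p => c ^ p.1) h₀)
    · exact (if_neg hxy.symm).trans ((if_pos rfl).trans (congrArg (fun p => c ^ p.2) h₀))
    · exact (if_neg hxz.symm).trans (if_neg hyz.symm)
  · intro hs M hM hΓ
    obtain ⟨hA, hsafe⟩ := h𝒞 M hM
    exact Model.satisfies_goalFm (h𝒜 _ hA).1 (h𝒜 _ hA).2 hsafe hR hs hΓ

end ModalFLew

namespace ModalFLew

open Relation (ReflTransGen)

/-! ### The reduction is computable -/

namespace Fm

/-- Encoding unfolds to `Fm.code`, so the arithmetic expression from that definition is the whole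
proof; likewise for the next connectives. -/
theorem primrec₂_mul : Primrec₂ Fm.mul := by
  refine Primrec.encode_iff.mp ?_
  have h : Primrec fun p : Fm × Fm =>
      7 * Nat.pair (Encodable.encode p.1) (Encodable.encode p.2) + 5 :=
    Primrec.nat_add.comp (Primrec.nat_mul.comp (Primrec.const 7)
      (Primrec₂.natPair.comp (Primrec.encode.comp Primrec.fst) (Primrec.encode.comp Primrec.snd)))
      (Primrec.const 5)
  exact h

theorem primrec₂_and : Primrec₂ Fm.and := by
  refine Primrec.encode_iff.mp ?_
  have h : Primrec fun p : Fm × Fm =>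
      7 * Nat.pair (Encodable.encode p.1) (Encodable.encode p.2) + 3 :=
    Primrec.nat_add.comp (Primrec.nat_mul.comp (Primrec.const 7)
      (Primrec₂.natPair.comp (Primrec.encode.comp Primrec.fst) (Primrec.encode.comp Primrec.snd)))
      (Primrec.const 3)
  exact h

theorem primrec₂_imp : Primrec₂ Fm.imp := by
  refine Primrec.encode_iff.mp ?_
  have h : Primrec fun p : Fm × Fm =>
      7 * Nat.pair (Encodable.encode p.1) (Encodable.encode p.2) + 6 :=
    Primrec.nat_add.comp (Primrec.nat_mul.comp (Primrec.const 7)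
      (Primrec₂.natPair.comp (Primrec.encode.comp Primrec.fst) (Primrec.encode.comp Primrec.snd)))
      (Primrec.const 6)
  exact h

theorem primrec_pow (φ : Fm) : Primrec φ.pow := by
  have h : Primrec fun n : ℕ => (Nat.rec Fm.one (fun _ ψ => Fm.mul ψ φ) n : Fm) :=
    Primrec.nat_rec' Primrec.id (Primrec.const Fm.one)
      (primrec₂_mul.comp (Primrec.snd.comp Primrec.snd) (Primrec.const φ)).to₂
  refine h.of_eq fun n => ?_
  induction n with
  | zero => rfl
  | succ n ih => rw [pow, ← ih]

theorem vars_pow_subset (φ : Fm) (n : ℕ) : (φ.pow n).vars ⊆ φ.vars := by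
  induction n with
  | zero => simp [pow, vars]
  | succ n ih => exact Finset.union_subset ih subset_rfl

end Fm

theorem primrec_startFm (x y z : ℕ) : Primrec (startFm x y z) := by
  have hp := Fm.primrec_pow (.var z)
  exact Fm.primrec₂_imp.comp (Primrec.const _) (Fm.primrec₂_and.comp
    (Fm.primrec₂_and.comp (Fm.primrec₂_imp.comp (Primrec.const _) hp)
      (Fm.primrec₂_imp.comp hp (Primrec.const _))) (Primrec.const _))

/-- The rules are fixed, so only the starting formula varies with the input. -/
theorem primrec_premises (x y z : ℕ) (R : List AffineRule) : Primrec (premises x y z R) :=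
  Primrec.list_cons.comp (Primrec.const _)
    (Primrec.list_cons.comp (primrec_startFm x y z) (Primrec.const _))

theorem vars_premises_subset {x y z : ℕ} {R : List AffineRule} {N : ℕ} :
    ∀ γ ∈ premises x y z R N, γ.vars ⊆ {x, y, z} := by
  have hpow : ∀ (φ : Fm) (n : ℕ), φ.vars ⊆ {x, y, z} → (φ.pow n).vars ⊆ {x, y, z} :=
    fun φ n h => (φ.vars_pow_subset n).trans h
  have hx : (Fm.var x).vars ⊆ {x, y, z} := by simp [Fm.vars]
  have hy : (Fm.var y).vars ⊆ {x, y, z} := by simp [Fm.vars]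
  have hz : (Fm.var z).vars ⊆ {x, y, z} := by simp [Fm.vars]
  have hR : (someStepFm x y z R).vars ⊆ {x, y, z} := by
    induction R with
    | nil =>
      simp only [someStepFm, List.foldr_nil, incrFm, Fm.iff, Fm.vars, Finset.union_subset_iff] at *
      tauto
    | cons ρ R ih =>
      have hz' := hpow (.var z) ρ.β hz
      have hz'' := hpow (.var z) (ρ.δ - ρ.β) hz
      have hy' := hpow (.box (.var y)) (ρ.α + 1) hy
      have hy'' := hpow (.box (.var y)) (ρ.γ - ρ.α - 1) hy
      refine Finset.union_subset ?_ ih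
      simp only [ruleFm, Fm.iff, Fm.vars, Finset.union_subset_iff] at *
      tauto
  have hN := hpow (.var z) N hz
  simp only [premises, List.mem_cons, List.not_mem_nil, or_false, forall_eq_or_imp, forall_eq,
    agreeFm, startFm, stepFm, hasSuccFm, Fm.iff, Fm.vars, Finset.union_subset_iff,
    Finset.empty_subset] at *
  tauto

theorem vars_goalFm_subset {x y z h : ℕ} : (goalFm x y z h).vars ⊆ {x, y, z} := by
  have hx : (Fm.var x).vars ⊆ {x, y, z} := by simp [Fm.vars]
  have hy : (Fm.var y).vars ⊆ {x, y, z} := by simp [Fm.vars]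
  have hz : (Fm.var z).vars ⊆ {x, y, z} := by simp [Fm.vars]
  have hy' := ((Fm.var y).vars_pow_subset (h + 1)).trans hy
  have hz' := ((Fm.var z).vars_pow_subset h).trans hz
  simp only [goalFm, Fm.iff, Fm.vars, Finset.union_subset_iff] at *
  tauto

/-- Classes of safe models over suitable chains that contain the models on finite chains have an
undecidable global logic. -/
theorem undecidableInThreeVariables {𝒜 : Set Alg.{v}} {𝒞 : Set Model.{u, v}}
    (h𝒜 : ∀ A ∈ 𝒜, A.IsChain ∧ A.IsWeaklySaturated) (hn : ∀ n : ℕ, ∃ A ∈ 𝒜, ¬ A.IsContractive n)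
    (h𝒞 : ∀ M ∈ 𝒞, M.alg ∈ 𝒜 ∧ M.Safe)
    (hL : ∀ M : Model.{u, v}, M.alg ∈ 𝒜 → M.Safe → M.frame ∈ chainFrames → M ∈ 𝒞) :
    UndecidableInThreeVariables 𝒞 := by
  obtain ⟨R, h, p, q, hR, hund⟩ := exists_undecidable_rewriting
  -- `P` need only agree with consequence on the instances used, so one argument covers the full
  -- logic and the fragments.
  have reduction : ∀ {x y z : ℕ}, x ≠ y → x ≠ z → y ≠ z → ∀ P : List Fm × Fm → Prop,
      (∀ N, P (premises x y z R N, goalFm x y z h) ↔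
        GloballyFollows 𝒞 {γ | γ ∈ premises x y z R N} (goalFm x y z h)) →
      ¬ ComputablePred P := by
    intro x y z hxy hxz hyz P hP hcomp
    refine hund ?_
    obtain ⟨f, hf, rfl⟩ := ComputablePred.computable_iff.mp hcomp
    have hN : Primrec fun n : ℕ => p * q ^ n := by
      have hq : Primrec fun n : ℕ => (Nat.rec 1 (fun _ m => m * q) n : ℕ) :=
        Primrec.nat_rec' Primrec.id (Primrec.const 1)
          (Primrec.nat_mul.comp (Primrec.snd.comp Primrec.snd) (Primrec.const q)).to₂
      refine Primrec.nat_mul.comp (Primrec.const p) (hq.of_eq fun n => ?_)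
      induction n with
      | zero => rfl
      | succ n ih => rw [pow_succ, ← ih]
    refine ComputablePred.computable_iff.mpr
      -- Negated, because the consequence holds exactly when the target is unreachable.
      ⟨fun n => !f (premises x y z R (p * q ^ n), goalFm x y z h),
        Primrec.not.to_comp.comp (hf.comp
          (((primrec_premises x y z R).comp hN).pair (Primrec.const _)).to_comp),
        funext fun n => propext ?_⟩
    rw [rewriting_iff_pairStep hR, Bool.not_eq_true', ← Bool.not_eq_true,
      show f (premises x y z R (p * q ^ n), goalFm x y z h) = true ↔ _ from hP _,
      globallyFollows_iff h𝒜 hn h𝒞 hL hxy hxz hyz hR, not_not]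
  refine ⟨reduction (x := 0) (y := 1) (z := 2) (by decide) (by decide) (by decide) _
      fun _ => Iff.rfl,
    fun V hV => ?_⟩
  obtain ⟨x, y, z, hxy, hxz, hyz, rfl⟩ := Finset.card_eq_three.mp hV
  exact reduction hxy hxz hyz _ fun N =>
    ⟨fun h => h.2.2, fun h => ⟨vars_premises_subset, vars_goalFm_subset, h⟩⟩

theorem undecidable_of_chains {𝒜 : Set Alg.{v}}
    (h𝒜 : ∀ A ∈ 𝒜, A.IsChain ∧ A.IsWeaklySaturated)
    (hn : ∀ n : ℕ, ∃ A ∈ 𝒜, ¬ A.IsContractive n) :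
    (∀ ℱ : Set Frame.{u}, chainFrames ⊆ ℱ → UndecidableInThreeVariables (modelsOver ℱ 𝒜)) ∧
      UndecidableInThreeVariables (K.{u, v} 𝒜) ∧
      UndecidableInThreeVariables (finiteModels (K.{u, v} 𝒜)) := by
  refine ⟨fun ℱ hℱ => undecidableInThreeVariables h𝒜 hn (fun M hM => hM.2)
      (fun M h₁ h₂ h₃ => ⟨hℱ h₃, h₁, h₂⟩),
    undecidableInThreeVariables h𝒜 hn (fun M hM => hM) (fun M h₁ h₂ _ => ⟨h₁, h₂⟩),
    undecidableInThreeVariables h𝒜 hn (fun M hM => hM.1) (fun M h₁ h₂ h₃ => ⟨⟨h₁, h₂⟩, ?_⟩)⟩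
  obtain ⟨k, ⟨e⟩⟩ := h₃
  exact Finite.of_equiv _ e.toEquiv.symm

/-! ### The standard algebras -/

theorem standardLukasiewicz_pow_coe (a : standardLukasiewicz) (n : ℕ) :
    ((a ^ n : standardLukasiewicz) : unitInterval).1 =
      max 0 (1 - n * (1 - (show unitInterval from a).1)) := by
  have ha := (show unitInterval from a).2.2
  induction n with
  | zero => rw [pow_zero]; change (1 : ℝ) = _; simp
  | succ n ih =>
    rw [pow_succ]
    change max 0 ((show unitInterval from a ^ n).1 + (show unitInterval from a).1 - 1) = _
    have h : ((n + 1 : ℕ) : ℝ) * (1 - (show unitInterval from a).1) =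
      n * (1 - (show unitInterval from a).1) + (1 - (show unitInterval from a).1) := by
        push_cast; ring
    rw [h, show (show unitInterval from a ^ n).1 = _ from ih]
    grind

theorem standardLukasiewicz_isWeaklySaturated : standardLukasiewicz.IsWeaklySaturated := by
  intro a b h
  by_cases hb : (show unitInterval from b).1 = 1
  · have : b = 1 := Subtype.ext hb
    rw [this, mul_one]
  · have hb' : 0 < 1 - (show unitInterval from b).1 :=
      sub_pos.mpr (lt_of_le_of_ne (show unitInterval from b).2.2 hb)
    -- For such `n` the power `b ^ n` is already 0, hence so is `a`.
    obtain ⟨n, hn⟩ := exists_nat_ge (1 / (1 - (show unitInterval from b).1))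
    rw [div_le_iff₀ hb'] at hn
    have h₁ : (show unitInterval from a).1 ≤ (show unitInterval from b ^ n).1 := h n
    rw [show (show unitInterval from b ^ n).1 = _ from standardLukasiewicz_pow_coe b n,
      max_eq_left (by linarith)] at h₁
    have ha := le_antisymm h₁ (show unitInterval from a).2.1
    refine le_antisymm (FLew.mul_le_left a b) ?_
    change (show unitInterval from a).1 ≤ _
    rw [ha]
    exact (show unitInterval from a * b).2.1

theorem standardLukasiewicz_not_isContractive (n : ℕ) : ¬ standardLukasiewicz.IsContractive n := by
  intro h
  have hn : (0 : ℝ) < n + 1 := by positivity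
  have hn' : 1 / ((n : ℝ) + 1) ≤ 1 := by
    rw [div_le_one hn]; linarith [(Nat.cast_nonneg n : (0 : ℝ) ≤ n)]
  -- Chosen so that `a ^ n` is `1 / (n + 1)` while `a ^ (n + 1)` is 0.
  let a : standardLukasiewicz := (⟨1 - 1 / (n + 1), by linarith, by
    linarith [(by positivity : (0 : ℝ) ≤ 1 / ((n : ℝ) + 1))]⟩ : unitInterval)
  have h₁ := standardLukasiewicz_pow_coe a n
  have h₂ := standardLukasiewicz_pow_coe a (n + 1)
  rw [h a, h₁] at h₂
  have ha : 1 - (show unitInterval from a).1 = 1 / (n + 1) := by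
    change 1 - (1 - 1 / ((n : ℝ) + 1)) = _; ring
  rw [ha, show ((n + 1 : ℕ) : ℝ) * (1 / (n + 1)) = 1 by push_cast; field_simp, sub_self,
    max_self, show 1 - (n : ℝ) * (1 / (n + 1)) = 1 / (n + 1) by field_simp; ring,
    max_eq_right (by positivity)] at h₂
  exact absurd h₂ (by positivity)

theorem standardProduct_pow_coe (a : standardProduct) (n : ℕ) :
    ((a ^ n : standardProduct) : unitInterval).1 = (show unitInterval from a).1 ^ n := by
  induction n with
  | zero => rw [pow_zero, pow_zero]; rfl
  | succ n ih => rw [pow_succ, pow_succ, ← ih]; rfl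

theorem standardProduct_isWeaklySaturated : standardProduct.IsWeaklySaturated := by
  intro a b h
  by_cases hb : (show unitInterval from b).1 = 1
  · have : b = 1 := Subtype.ext hb
    rw [this, mul_one]
  · have h₁ : (show unitInterval from a).1 ≤ 0 := by
      refine ge_of_tendsto' (tendsto_pow_atTop_nhds_zero_of_lt_one
        (show unitInterval from b).2.1 (lt_of_le_of_ne (show unitInterval from b).2.2 hb))
        fun n => ?_
      rw [← standardProduct_pow_coe]
      exact h n
    have ha := le_antisymm h₁ (show unitInterval from a).2.1
    refine le_antisymm (FLew.mul_le_left a b) ?_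
    change (show unitInterval from a).1 ≤ _
    rw [ha]
    exact (show unitInterval from a * b).2.1

theorem standardProduct_not_isContractive (n : ℕ) : ¬ standardProduct.IsContractive n := by
  intro h
  let a : standardProduct := (⟨1 / 2, by norm_num, by norm_num⟩ : unitInterval)
  have h₁ := standardProduct_pow_coe a n
  have h₂ := standardProduct_pow_coe a (n + 1)
  rw [h a, h₁] at h₂
  change (1 / 2 : ℝ) ^ n = (1 / 2 : ℝ) ^ (n + 1) at h₂
  have : (0 : ℝ) < (1 / 2) ^ n := by positivity
  rw [pow_succ] at h₂
  linarith

theorem standardLukasiewicz_isChain : standardLukasiewicz.IsChain :=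
  fun a b => le_total (show unitInterval from a) (show unitInterval from b)

theorem standardProduct_isChain : standardProduct.IsChain :=
  fun a b => le_total (show unitInterval from a) (show unitInterval from b)

end ModalFLew

theorem mainTheorem2 :
    (∀ 𝒜 : Set ModalFLew.Alg.{v},
      (∀ A ∈ 𝒜, A.IsChain ∧ A.IsWeaklySaturated) →
      (∀ n : ℕ, ∃ A ∈ 𝒜, ¬ A.IsContractive n) →
      (∀ ℱ : Set ModalFLew.Frame.{u}, ModalFLew.chainFrames ⊆ ℱ →
        ModalFLew.UndecidableInThreeVariables (ModalFLew.modelsOver ℱ 𝒜)) ∧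
      ModalFLew.UndecidableInThreeVariables (ModalFLew.K.{u, v} 𝒜) ∧
      ModalFLew.UndecidableInThreeVariables (ModalFLew.finiteModels (ModalFLew.K.{u, v} 𝒜))) ∧
    (∀ A ∈ ({ModalFLew.standardLukasiewicz, ModalFLew.standardProduct} : Set ModalFLew.Alg.{0}),
      (∀ ℱ : Set ModalFLew.Frame.{u}, ModalFLew.chainFrames ⊆ ℱ →
        ModalFLew.UndecidableInThreeVariables (ModalFLew.modelsOver ℱ {A})) ∧
      ModalFLew.UndecidableInThreeVariables (ModalFLew.K.{u, 0} {A}) ∧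
      ModalFLew.UndecidableInThreeVariables
        (ModalFLew.finiteModels (ModalFLew.K.{u, 0} {A}))) := by
  refine ⟨fun 𝒜 h𝒜 hn => ModalFLew.undecidable_of_chains h𝒜 hn, fun A hA => ?_⟩
  rcases hA with rfl | rfl
  · exact ModalFLew.undecidable_of_chains
      (by rintro _ rfl; exact ⟨ModalFLew.standardLukasiewicz_isChain,
            ModalFLew.standardLukasiewicz_isWeaklySaturated⟩)
      fun n => ⟨_, rfl, ModalFLew.standardLukasiewicz_not_isContractive n⟩
  · exact ModalFLew.undecidable_of_chains
      (by rintro _ rfl; exact ⟨ModalFLew.standardProduct_isChain,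
            ModalFLew.standardProduct_isWeaklySaturated⟩)
      fun n => ⟨_, rfl, ModalFLew.standardProduct_not_isContractive n⟩
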